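/- Let $\Omega\subset\mathbb R^2\cong\mathbb C$ be a domain, $1<p<\infty$, $p\ne 2$, and let $u=(u^1,u^2)\in C^2(\Omega,\mathbb R^2)$ be a $p$-harmonic map, that is, a weak solution of $\operatorname{div}(|Du|^{p-2}\nabla u^i)=0$, $i=1,2$, where $|Du|^2=|\nabla u^1|^2+|\nabla u^2|^2$. Let $f=\frac12(u^1_x-iu^1_y)$ and $g=\frac12(u^2_x-iu^2_y)$ be the complex gradients, let $H(u^i)$ denote the Hessian matrix, and let $$k_{v}=-\frac{v_y^2v_{xx}-2v_xv_yv_{xy}+v_x^2v_{yy}}{|\nabla v|^3}=-\operatorname{div}\Big(\frac{\nabla v}{|\nabla v|}\Big)$$ be the curvature function of the level curves of $v$, defined where $\nabla v\neq0$. A map $F$ is called quasiregular in an open set $U$ if it is continuous, belongs to $W^{1,2}_{loc}(U)$, and satisfies $|F_{\bar z}|\le k|F_z|$ a.e. in $U$ for some constant $k<1$. Let $C>0$, and let $B=B(z_0,R)\subset\Omega$, $R>0$, be an open ball. Suppose that one of the following holds: (1) $\|H(u^1)\|,\|H(u^2)\|\in L^2(B)$ (Euclidean norms) and $|f|>C$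 in $B$; (2) $f_z,g_z\in L^2(B)$ and $|f|>C$ in $B$; (3) $\overline B\subset\Omega$, $f$ and $g$ are quasiregular in $B$, and $|f|>C$ in $B$; (4) $\overline B\subset\Omega$, $f$ and $g$ are quasiregular in $B$, and $|f(z)|>C|z-z_0|^{\alpha}$ for all $z\in B\setminus\{z_0\}$, with some $\alpha<1$. Then $k_{u^1}\in L^1(B)$. If, moreover, all critical points of $u^1$ in $\Omega$ are isolated, and $c\in\mathbb R$ is such that $\{u^1=c\}\cap B$ is nonempty and contains no critical point of $u^1$, then $$L(c):=\mathcal H^1(\{z\in\Omega: u^1(z)=c\}\cap B)\le\int_{\Omega\cap B}|k_{u^1}|+2\pi R.$$ The same holds for $u^2$, with $|f|$ replaced by $|g|$ in the lower bounds of (1)–(4) and $k_{u^1}$ by $k_{u^2}$. -/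

import Mathlib

open MeasureTheory Set Filter
open scoped Topology ContDiff

noncomputable section

/-! The plane is `ℂ` with its real structure, `z = x + i y`. -/

/-- First partial derivative in `x` of a function on the plane. -/
def dx (v : ℂ → ℝ) (z : ℂ) : ℝ := fderiv ℝ v z 1

/-- First partial derivative in `y` of a function on the plane. -/
def dy (v : ℂ → ℝ) (z : ℂ) : ℝ := fderiv ℝ v z Complex.I

/-- The Euclidean norm of the gradient. -/
def gradNorm (v : ℂ → ℝ) (z : ℂ) : ℝ := Real.sqrt (dx v z ^ 2 + dy v z ^ 2)

/-- The Euclidean (Hilbert–Schmidt) norm of the Hessian. -/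
def hessNorm (v : ℂ → ℝ) (z : ℂ) : ℝ :=
  Real.sqrt (dx (dx v) z ^ 2 + dy (dx v) z ^ 2 + dx (dy v) z ^ 2 + dy (dy v) z ^ 2)

/-- The curvature function `-div (∇v / |∇v|)` of the level curves of a `C²` function `v`, written
out at the points where `∇v ≠ 0`. At critical points the value is `0` by convention. -/
def levelCurvature (v : ℂ → ℝ) (z : ℂ) : ℝ :=
  -((dy v z ^ 2 * dx (dx v) z - 2 * dx v z * dy v z * dy (dx v) z + dx v z ^ 2 * dy (dy v) z)
    / gradNorm v z ^ 3)

/-- The complex gradient `(v_x - i v_y) / 2`. -/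
def complexGrad (v : ℂ → ℝ) (z : ℂ) : ℂ := (1 / 2 : ℂ) * ((dx v z : ℂ) - Complex.I * (dy v z : ℂ))

/-- The Wirtinger derivative `F_z = (F_x - i F_y) / 2`. -/
def wirtingerZ (F : ℂ → ℂ) (z : ℂ) : ℂ :=
  (1 / 2 : ℂ) * (fderiv ℝ F z 1 - Complex.I * fderiv ℝ F z Complex.I)

/-- The `i`-th coordinate function of a planar map. -/
def coord (u : ℂ → Fin 2 → ℝ) (i : Fin 2) (z : ℂ) : ℝ := u z i

/-- `|Du|`, where `|Du|² = |∇u¹|² + |∇u²|²`. -/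
def jacNorm (u : ℂ → Fin 2 → ℝ) (z : ℂ) : ℝ :=
  Real.sqrt (gradNorm (coord u 0) z ^ 2 + gradNorm (coord u 1) z ^ 2)

/-- Real-valued test functions, smooth with compact support in `U`. -/
def IsTest (U : Set ℂ) (φ : ℂ → ℝ) : Prop :=
  ContDiff ℝ ∞ φ ∧ HasCompactSupport φ ∧ tsupport φ ⊆ U

/-- Weak form of `div (|Du|^{p-2} Du) = 0` in `Ω`, for a continuously differentiable map `u` and
`1 < p < ∞`. The field `|Du|^{p-2} ∇uⁱ` is zero where `Du = 0`, also for `p < 2`. -/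
def IsPHarmonicMap (p : ℝ) (Ω : Set ℂ) (u : ℂ → Fin 2 → ℝ) : Prop :=
  ∀ (i : Fin 2) (φ : ℂ → ℝ), IsTest Ω φ →
    ∫ z in Ω, jacNorm u z ^ (p - 2) *
      (dx (coord u i) z * dx φ z + dy (coord u i) z * dy φ z) = 0

/-- `G` is the weak derivative of `F` in the direction `e` on `U`. -/
def IsWeakDeriv (U : Set ℂ) (e : ℂ) (F G : ℂ → ℂ) : Prop :=
  ∀ φ : ℂ → ℝ, IsTest U φ →
    ∫ z in U, ((fderiv ℝ φ z e : ℝ) : ℂ) * F z = -∫ z in U, ((φ z : ℝ) : ℂ) * G z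

/-- `F` is quasiregular in the open set `U`: it is continuous, it lies in `W^{1,2}_loc(U)`, and
`|F_{z̄}| ≤ k |F_z|` almost everywhere in `U` for some constant `k < 1`. -/
def QuasiregularOn (F : ℂ → ℂ) (U : Set ℂ) : Prop :=
  ContinuousOn F U ∧
  ∃ Fx Fy : ℂ → ℂ,
    (∀ K : Set ℂ, IsCompact K → K ⊆ U →
      MemLp Fx 2 (volume.restrict K) ∧ MemLp Fy 2 (volume.restrict K)) ∧
    IsWeakDeriv U 1 F Fx ∧ IsWeakDeriv U Complex.I F Fy ∧
    ∃ k : ℝ, 0 ≤ k ∧ k < 1 ∧ ∀ᵐ z ∂(volume.restrict U),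
      ‖(1 / 2 : ℂ) * (Fx z + Complex.I * Fy z)‖ ≤
        k * ‖(1 / 2 : ℂ) * (Fx z - Complex.I * Fy z)‖

/-- The critical points of `v` in `Ω`. -/
def criticalSet (v : ℂ → ℝ) (Ω : Set ℂ) : Set ℂ := {z ∈ Ω | dx v z = 0 ∧ dy v z = 0}

end

/-!
For `δ > 0` the field `∇v / √(|∇v|² + δ²)` is `C¹` even across critical points of `v`. Integrating
its divergence against `χ h(v)`, with a cutoff `χ` and a step function `h` jumping from `-1/2` to
`1/2` across the value `c`, and letting `δ → 0`, gives
`∫ χ h'(v) |∇v| ≤ 1/2 (∫ |k_v| + ∫ |∇χ|)` as soon as `‖H(v)‖ / |∇v|` is integrable. A radial `χ`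
makes the last integral at most `2πR`.

Near a regular point the level set is a graph over a tangent direction, which already gives
`ℋ¹ ≤ 2 ∫ h'(v) |∇v|` for thin layers: each line in the normal direction carries layer mass at
least `1`, and on the level set the projection along these lines contracts distances by at most a
factor `2`, exactly the loss that the factor `1/2` above makes up for. Compactness patches the local
bounds without counting a layer twice.

It remains to see that `‖H(uⁱ)‖ / |∇uⁱ|` is integrable, which bounds `|k_{uⁱ}|` as well. In case (2)
the equations in non-divergence form are an elliptic linear system for the Laplacians `Δu¹`, `Δu²`,
which bounds both Hessians by `|f_z| + |g_z|`. In cases (3) and (4) the Hessian is bounded on the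
closed ball, and `|z - z₀|^{-α}` is integrable in the plane for every `α < 2`.
-/

section PartialDerivatives

variable {v χ : ℂ → ℝ} {Ω : Set ℂ} {z : ℂ} {m n : WithTop ℕ∞}

theorem fderiv_apply_eq (v : ℂ → ℝ) (z e : ℂ) :
    fderiv ℝ v z e = e.re * dx v z + e.im * dy v z := by
  conv_lhs => rw [← Complex.re_add_im e]
  have hre : (e.re : ℂ) = e.re • (1 : ℂ) := by simp
  have him : e.im * Complex.I = e.im • Complex.I := by simp
  rw [hre, him, map_add, map_smul, map_smul]
  rfl

/-- The gradient of a real function on the plane, as the complex number `v_x + i v_y`; it is twice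
the conjugate of `complexGrad`. -/
noncomputable def gradVec (v : ℂ → ℝ) (z : ℂ) : ℂ := ⟨dx v z, dy v z⟩

theorem norm_gradVec (v : ℂ → ℝ) (z : ℂ) : ‖gradVec v z‖ = gradNorm v z :=
  Complex.norm_eq_sqrt_sq_add_sq (gradVec v z)

theorem gradNorm_eq_norm_fderiv (v : ℂ → ℝ) (z : ℂ) : gradNorm v z = ‖fderiv ℝ v z‖ := by
  have h : fderiv ℝ v z = innerSL ℝ (gradVec v z) := by
    ext e
    rw [fderiv_apply_eq, innerSL_apply_apply, Complex.inner]
    simp only [gradVec, Complex.mul_re, Complex.conj_re, Complex.conj_im]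
    ring
  rw [h, innerSL_apply_norm, norm_gradVec]

theorem gradNorm_nonneg (v : ℂ → ℝ) (z : ℂ) : 0 ≤ gradNorm v z := Real.sqrt_nonneg _

theorem gradNorm_sq (v : ℂ → ℝ) (z : ℂ) : gradNorm v z ^ 2 = dx v z ^ 2 + dy v z ^ 2 :=
  Real.sq_sqrt (by positivity)

theorem abs_dx_mul_dx_add_dy_mul_dy_le (v χ : ℂ → ℝ) (z : ℂ) :
    |dx χ z * dx v z + dy χ z * dy v z| ≤ gradNorm χ z * gradNorm v z := by
  have h := (fderiv ℝ χ z).le_opNorm (gradVec v z)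
  rwa [← gradNorm_eq_norm_fderiv, norm_gradVec, fderiv_apply_eq, Real.norm_eq_abs,
    mul_comm _ (dx χ z), mul_comm _ (dy χ z)] at h

theorem measurable_gradNorm (v : ℂ → ℝ) : Measurable (gradNorm v) := by
  simpa only [funext (gradNorm_eq_norm_fderiv v)] using (measurable_fderiv ℝ v).norm

theorem measurable_dx (v : ℂ → ℝ) : Measurable (dx v) := measurable_fderiv_apply_const ℝ v 1

theorem measurable_dy (v : ℂ → ℝ) : Measurable (dy v) :=
  measurable_fderiv_apply_const ℝ v Complex.I

theorem hessNorm_nonneg (v : ℂ → ℝ) (z : ℂ) : 0 ≤ hessNorm v z := Real.sqrt_nonneg _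

theorem measurable_hessNorm (v : ℂ → ℝ) : Measurable (hessNorm v) :=
  (((((measurable_dx (dx v)).pow_const 2).add ((measurable_dy (dx v)).pow_const 2)).add
    ((measurable_dx (dy v)).pow_const 2)).add ((measurable_dy (dy v)).pow_const 2)).sqrt

theorem contDiffOn_fderiv_apply (hΩ : IsOpen Ω) (hv : ContDiffOn ℝ n v Ω) (hmn : m + 1 ≤ n)
    (e : ℂ) : ContDiffOn ℝ m (fun z => fderiv ℝ v z e) Ω :=
  (hv.fderiv_of_isOpen hΩ hmn).clm_apply contDiffOn_const

theorem contDiffOn_dx (hΩ : IsOpen Ω) (hv : ContDiffOn ℝ 2 v Ω) : ContDiffOn ℝ 1 (dx v) Ω :=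
  contDiffOn_fderiv_apply hΩ hv one_add_one_eq_two.le 1

theorem contDiffOn_dy (hΩ : IsOpen Ω) (hv : ContDiffOn ℝ 2 v Ω) : ContDiffOn ℝ 1 (dy v) Ω :=
  contDiffOn_fderiv_apply hΩ hv one_add_one_eq_two.le Complex.I

theorem continuousOn_dx (hΩ : IsOpen Ω) (hv : ContDiffOn ℝ 1 v Ω) : ContinuousOn (dx v) Ω :=
  (contDiffOn_fderiv_apply hΩ hv (zero_add 1).le 1).continuousOn

theorem continuousOn_dy (hΩ : IsOpen Ω) (hv : ContDiffOn ℝ 1 v Ω) : ContinuousOn (dy v) Ω :=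
  (contDiffOn_fderiv_apply hΩ hv (zero_add 1).le Complex.I).continuousOn

theorem continuousOn_gradNorm (hΩ : IsOpen Ω) (hv : ContDiffOn ℝ 1 v Ω) :
    ContinuousOn (gradNorm v) Ω :=
  (((continuousOn_dx hΩ hv).pow 2).add ((continuousOn_dy hΩ hv).pow 2)).sqrt

theorem continuousOn_hessNorm (hΩ : IsOpen Ω) (hv : ContDiffOn ℝ 2 v Ω) :
    ContinuousOn (hessNorm v) Ω :=
  (((((continuousOn_dx hΩ (contDiffOn_dx hΩ hv)).pow 2).add
    ((continuousOn_dy hΩ (contDiffOn_dx hΩ hv)).pow 2)).add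
    ((continuousOn_dx hΩ (contDiffOn_dy hΩ hv)).pow 2)).add
    ((continuousOn_dy hΩ (contDiffOn_dy hΩ hv)).pow 2)).sqrt

theorem differentiableAt_of_mem (hΩ : IsOpen Ω) (hv : ContDiffOn ℝ 1 v Ω) (hz : z ∈ Ω) :
    DifferentiableAt ℝ v z :=
  (hv.contDiffAt (hΩ.mem_nhds hz)).differentiableAt one_ne_zero

theorem dx_dy_eq_dy_dx (hΩ : IsOpen Ω) (hv : ContDiffOn ℝ 2 v Ω) (hz : z ∈ Ω) :
    dx (dy v) z = dy (dx v) z := by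
  have hvz : ContDiffAt ℝ 2 v z := hv.contDiffAt (hΩ.mem_nhds hz)
  have hd : DifferentiableAt ℝ (fderiv ℝ v) z :=
    (hvz.fderiv_right one_add_one_eq_two.le).differentiableAt one_ne_zero
  have key (e w : ℂ) : fderiv ℝ (fun y => fderiv ℝ v y e) z w = fderiv ℝ (fderiv ℝ v) z w e := by
    simp [fderiv_clm_apply hd (differentiableAt_const e)]
  have hsymm := (hvz.isSymmSndFDerivAt (by simp)).eq 1 Complex.I
  rwa [← key, ← key] at hsymm

theorem dx_mul (hv : DifferentiableAt ℝ v z) (hχ : DifferentiableAt ℝ χ z) :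
    dx (fun w => v w * χ w) z = v z * dx χ z + χ z * dx v z := by
  simp [dx, fderiv_fun_mul hv hχ]

theorem dy_mul (hv : DifferentiableAt ℝ v z) (hχ : DifferentiableAt ℝ χ z) :
    dy (fun w => v w * χ w) z = v z * dy χ z + χ z * dy v z := by
  simp [dy, fderiv_fun_mul hv hχ]

theorem fderiv_comp_apply {h : ℝ → ℝ} (hh : DifferentiableAt ℝ h (v z))
    (hv : DifferentiableAt ℝ v z) (e : ℂ) :
    fderiv ℝ (fun w => h (v w)) z e = deriv h (v z) * fderiv ℝ v z e :=
  DFunLike.congr_fun (hh.hasDerivAt.comp_hasFDerivAt z hv.hasFDerivAt).fderiv e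

end PartialDerivatives

section IntegrationByParts

theorem integrable_mul_of_tsupport_subset {X : Type*} [TopologicalSpace X] [MeasurableSpace X]
    [OpensMeasurableSpace X] {μ : Measure X} [IsFiniteMeasureOnCompacts μ]
    {ζ A : X → ℝ} {Ω : Set X} (hζ : Continuous ζ) (hζc : HasCompactSupport ζ)
    (hζΩ : tsupport ζ ⊆ Ω) (hA : ContinuousOn A Ω) : Integrable (fun x => ζ x * A x) μ :=
  ((hζ.continuousOn.mul (hA.mono hζΩ)).integrableOn_compact' hζc
    (isClosed_tsupport ζ).measurableSet).integrable_of_forall_notMem_eq_zero fun x hx => by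
      simp [image_eq_zero_of_notMem_tsupport hx]

theorem integral_mul_fderiv_eq_neg_of_tsupport_subset {E : Type*} [NormedAddCommGroup E]
    [NormedSpace ℝ E] [FiniteDimensional ℝ E] [MeasurableSpace E] [BorelSpace E]
    {μ : Measure E} [μ.IsAddHaarMeasure] {ζ A : E → ℝ} {Ω : Set E} (hΩ : IsOpen Ω)
    (hζ : ContDiff ℝ 1 ζ) (hζc : HasCompactSupport ζ) (hζΩ : tsupport ζ ⊆ Ω)
    (hA : ContDiffOn ℝ 1 A Ω) (e : E) :
    ∫ x, ζ x * fderiv ℝ A x e ∂μ = -∫ x, fderiv ℝ ζ x e * A x ∂μ :=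
  integral_mul_fderiv_eq_neg_fderiv_mul_of_integrable
    (integrable_mul_of_tsupport_subset
      ((hζ.continuous_fderiv one_ne_zero).clm_apply continuous_const)
      (hζc.fderiv_apply ℝ e) ((tsupport_fderiv_apply_subset ℝ e).trans hζΩ) hA.continuousOn)
    (integrable_mul_of_tsupport_subset hζ.continuous hζc hζΩ
      ((hA.continuousOn_fderiv_of_isOpen hΩ le_rfl).clm_apply continuousOn_const))
    (integrable_mul_of_tsupport_subset hζ.continuous hζc hζΩ hA.continuousOn)
    (fun _ _ => hζ.differentiable one_ne_zero _)
    (fun _ hx => (hA.contDiffAt (hΩ.mem_nhds (hζΩ hx))).differentiableAt one_ne_zero)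

theorem integral_mul_divergence_eq_neg {ζ P Q : ℂ → ℝ} {Ω : Set ℂ} (hΩ : IsOpen Ω)
    (hζ : ContDiff ℝ 1 ζ) (hζc : HasCompactSupport ζ) (hζΩ : tsupport ζ ⊆ Ω)
    (hP : ContDiffOn ℝ 1 P Ω) (hQ : ContDiffOn ℝ 1 Q Ω) :
    ∫ z, ζ z * (dx P z + dy Q z) = -∫ z, (dx ζ z * P z + dy ζ z * Q z) := by
  have integrable_left {A : ℂ → ℝ} (hA : ContinuousOn A Ω) :
      Integrable fun z => ζ z * A z :=
    integrable_mul_of_tsupport_subset hζ.continuous hζc hζΩ hA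
  have integrable_right (e : ℂ) {A : ℂ → ℝ} (hA : ContDiffOn ℝ 1 A Ω) :
      Integrable fun z => fderiv ℝ ζ z e * A z :=
    integrable_mul_of_tsupport_subset
      ((hζ.continuous_fderiv one_ne_zero).clm_apply continuous_const)
      (hζc.fderiv_apply ℝ e) ((tsupport_fderiv_apply_subset ℝ e).trans hζΩ) hA.continuousOn
  calc ∫ z, ζ z * (dx P z + dy Q z) = (∫ z, ζ z * dx P z) + ∫ z, ζ z * dy Q z := by
        simp only [mul_add]
        exact integral_add (integrable_left (continuousOn_dx hΩ hP))
          (integrable_left (continuousOn_dy hΩ hQ))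
    _ = -(∫ z, dx ζ z * P z) + -∫ z, dy ζ z * Q z := congrArg₂ (· + ·)
        (integral_mul_fderiv_eq_neg_of_tsupport_subset hΩ hζ hζc hζΩ hP 1)
        (integral_mul_fderiv_eq_neg_of_tsupport_subset hΩ hζ hζc hζΩ hQ Complex.I)
    _ = -∫ z, (dx ζ z * P z + dy ζ z * Q z) := by
        rw [← neg_add]
        exact congrArg Neg.neg
          (integral_add (integrable_right 1 hP) (integrable_right Complex.I hQ)).symm

end IntegrationByParts

section RegularizedCurvature

/-- The regularized gradient norm `√(|∇v|² + δ²)`, which for `δ ≠ 0` may be divided by at critical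
points too. -/
noncomputable def regGradNorm (v : ℂ → ℝ) (δ : ℝ) (z : ℂ) : ℝ := √(gradNorm v z ^ 2 + δ ^ 2)

/-- The regularized curvature `-div (∇v / √(|∇v|² + δ²))`, written out as in `levelCurvature`, to
which it reduces for `δ = 0`. -/
noncomputable def regCurvature (v : ℂ → ℝ) (δ : ℝ) (z : ℂ) : ℝ :=
  -((dy v z ^ 2 * dx (dx v) z - 2 * dx v z * dy v z * dy (dx v) z + dx v z ^ 2 * dy (dy v) z
    + δ ^ 2 * (dx (dx v) z + dy (dy v) z)) / regGradNorm v δ z ^ 3)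

variable {v : ℂ → ℝ} {Ω : Set ℂ} {z : ℂ} {δ : ℝ}

theorem regGradNorm_sq (v : ℂ → ℝ) (δ : ℝ) (z : ℂ) :
    regGradNorm v δ z ^ 2 = gradNorm v z ^ 2 + δ ^ 2 :=
  Real.sq_sqrt (by positivity)

theorem regGradNorm_nonneg (v : ℂ → ℝ) (δ : ℝ) (z : ℂ) : 0 ≤ regGradNorm v δ z :=
  Real.sqrt_nonneg _

theorem regGradNorm_pos (hδ : δ ≠ 0) : 0 < regGradNorm v δ z := Real.sqrt_pos.2 (by positivity)

theorem gradNorm_le_regGradNorm : gradNorm v z ≤ regGradNorm v δ z :=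
  Real.le_sqrt_of_sq_le (le_add_of_nonneg_right (sq_nonneg δ))

theorem regGradNorm_zero (v : ℂ → ℝ) : regGradNorm v 0 = gradNorm v := by
  ext z
  simp [regGradNorm, Real.sqrt_sq (gradNorm_nonneg v z)]

theorem regCurvature_zero (v : ℂ → ℝ) : regCurvature v 0 = levelCurvature v := by
  ext z
  simp [regCurvature, levelCurvature, regGradNorm_zero]

theorem measurable_regGradNorm (v : ℂ → ℝ) (δ : ℝ) : Measurable (regGradNorm v δ) :=
  ((measurable_gradNorm v).pow_const 2).add_const _ |>.sqrt

theorem measurable_regCurvature (v : ℂ → ℝ) (δ : ℝ) : Measurable (regCurvature v δ) := by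
  have := measurable_dx v
  have := measurable_dy v
  have := measurable_dx (dx v)
  have := measurable_dy (dx v)
  have := measurable_dy (dy v)
  have := measurable_regGradNorm v δ
  unfold regCurvature
  fun_prop

theorem continuous_regGradNorm_param (v : ℂ → ℝ) (z : ℂ) :
    Continuous fun δ => regGradNorm v δ z := by
  unfold regGradNorm
  fun_prop

theorem continuousAt_regCurvature_zero (hz : gradNorm v z ≠ 0) :
    ContinuousAt (fun δ => regCurvature v δ z) 0 := by
  unfold regCurvature
  refine ((ContinuousAt.div (by fun_prop)
    ((continuous_regGradNorm_param v z).pow 3).continuousAt ?_).neg)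
  exact pow_ne_zero 3 (by simpa only [regGradNorm_zero] using hz)

theorem abs_hessian_quadratic_le (v : ℂ → ℝ) (z : ℂ) :
    |dy v z ^ 2 * dx (dx v) z - 2 * dx v z * dy v z * dy (dx v) z + dx v z ^ 2 * dy (dy v) z| ≤
      2 * hessNorm v z * gradNorm v z ^ 2 := by
  refine abs_le_of_sq_le_sq ?_ (by unfold hessNorm; positivity)
  rw [mul_pow, mul_pow, hessNorm, Real.sq_sqrt (by positivity), gradNorm_sq]
  generalize dx v z = a, dy v z = b, dx (dx v) z = p, dy (dx v) z = q, dx (dy v) z = r,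
    dy (dy v) z = s
  have cauchy_schwarz : (b ^ 2 * p - 2 * a * b * q + a ^ 2 * s) ^ 2 ≤
      ((b ^ 2) ^ 2 + (2 * a * b) ^ 2 + (a ^ 2) ^ 2) * (p ^ 2 + q ^ 2 + s ^ 2) := by
    nlinarith [sq_nonneg (b ^ 2 * q + 2 * a * b * p), sq_nonneg (b ^ 2 * s - a ^ 2 * p),
      sq_nonneg (2 * a * b * s + a ^ 2 * q)]
  refine cauchy_schwarz.trans ?_
  nlinarith [mul_nonneg (sq_nonneg (a ^ 2 + b ^ 2)) (sq_nonneg r),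
    mul_nonneg (add_nonneg (sq_nonneg (a ^ 2)) (sq_nonneg (b ^ 2)))
      (add_nonneg (add_nonneg (sq_nonneg p) (sq_nonneg q)) (sq_nonneg s)),
    mul_nonneg (sq_nonneg (a * b))
      (add_nonneg (add_nonneg (sq_nonneg p) (sq_nonneg q)) (sq_nonneg s))]

theorem abs_laplacian_le (v : ℂ → ℝ) (z : ℂ) :
    |dx (dx v) z + dy (dy v) z| ≤ 2 * hessNorm v z := by
  refine abs_le_of_sq_le_sq ?_ (by unfold hessNorm; positivity)
  rw [mul_pow, hessNorm, Real.sq_sqrt (by positivity)]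
  nlinarith [sq_nonneg (dx (dx v) z - dy (dy v) z), sq_nonneg (dy (dx v) z),
    sq_nonneg (dx (dy v) z), sq_nonneg (dx (dx v) z), sq_nonneg (dy (dy v) z)]

theorem abs_regCurvature_le (δ : ℝ) (hz : gradNorm v z ≠ 0) :
    |regCurvature v δ z| ≤ 2 * (hessNorm v z / gradNorm v z) := by
  have hG : 0 < gradNorm v z := (gradNorm_nonneg v z).lt_of_ne' hz
  have hGW : gradNorm v z ≤ regGradNorm v δ z := gradNorm_le_regGradNorm
  have hW : 0 < regGradNorm v δ z := hG.trans_le hGW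
  have hH : 0 ≤ hessNorm v z := hessNorm_nonneg v z
  rw [regCurvature, abs_neg, abs_div, abs_of_pos (pow_pos hW 3)]
  calc _ ≤ (2 * hessNorm v z * gradNorm v z ^ 2 + δ ^ 2 * (2 * hessNorm v z)) /
          regGradNorm v δ z ^ 3 := by
        gcongr
        refine (abs_add_le _ _).trans (add_le_add (abs_hessian_quadratic_le v z) ?_)
        rw [abs_mul, abs_of_nonneg (sq_nonneg δ)]
        gcongr
        exact abs_laplacian_le v z
    _ = 2 * hessNorm v z * regGradNorm v δ z ^ 2 / regGradNorm v δ z ^ 3 := by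
        rw [regGradNorm_sq]
        ring
    _ = 2 * (hessNorm v z / regGradNorm v δ z) := by field_simp
    _ ≤ 2 * (hessNorm v z / gradNorm v z) := by gcongr

theorem contDiffOn_inv_regGradNorm (hΩ : IsOpen Ω) (hv : ContDiffOn ℝ 2 v Ω) (hδ : δ ≠ 0) :
    ContDiffOn ℝ 1 (fun z => (regGradNorm v δ z)⁻¹) Ω := by
  simp only [regGradNorm, gradNorm_sq]
  exact ((((contDiffOn_dx hΩ hv).pow 2).add ((contDiffOn_dy hΩ hv).pow 2)).add
    contDiffOn_const).sqrt (fun z _ => by positivity) |>.inv fun z _ => by positivity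

theorem fderiv_inv_regGradNorm (hδ : δ ≠ 0) (hdx : DifferentiableAt ℝ (dx v) z)
    (hdy : DifferentiableAt ℝ (dy v) z) (e : ℂ) :
    fderiv ℝ (fun w => (regGradNorm v δ w)⁻¹) z e =
      -(dx v z * fderiv ℝ (dx v) z e + dy v z * fderiv ℝ (dy v) z e) / regGradNorm v δ z ^ 3 := by
  have hW : regGradNorm v δ = fun w => √(dx v w ^ 2 + dy v w ^ 2 + δ ^ 2) := by
    ext w
    rw [regGradNorm, gradNorm_sq]
  have hsqrt := (((hdx.hasFDerivAt.pow 2).add (hdy.hasFDerivAt.pow 2)).add_const (δ ^ 2)).sqrt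
    (by simp only [Pi.add_apply]; positivity)
  have hWz : regGradNorm v δ z ≠ 0 := (regGradNorm_pos hδ).ne'
  have hinv := (hasDerivAt_inv (x := regGradNorm v δ z) hWz).comp_hasFDerivAt_of_eq z
    (hW ▸ hsqrt) rfl
  refine (DFunLike.congr_fun hinv.fderiv e).trans ?_
  simp only [hW] at hWz ⊢
  simp only [Pi.add_apply, one_div, mul_inv_rev, Nat.add_one_sub_one, pow_one, nsmul_eq_mul,
    Nat.cast_ofNat, smul_add, neg_smul, add_apply, neg_apply, smul_apply, smul_eq_mul, neg_add_rev]
  field_simp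
  ring

theorem dx_add_dy_regularized_field (hΩ : IsOpen Ω) (hv : ContDiffOn ℝ 2 v Ω) (hδ : δ ≠ 0)
    (hz : z ∈ Ω) :
    dx (fun w => dx v w * (regGradNorm v δ w)⁻¹) z + dy (fun w => dy v w * (regGradNorm v δ w)⁻¹) z
      = -regCurvature v δ z := by
  have differentiableAt {f : ℂ → ℝ} (hf : ContDiffOn ℝ 1 f Ω) : DifferentiableAt ℝ f z :=
    (hf.differentiableOn one_ne_zero).differentiableAt (hΩ.mem_nhds hz)
  have hdx := differentiableAt (contDiffOn_dx hΩ hv)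
  have hdy := differentiableAt (contDiffOn_dy hΩ hv)
  have hinv := differentiableAt (contDiffOn_inv_regGradNorm hΩ hv hδ)
  have hW : regGradNorm v δ z ≠ 0 := (regGradNorm_pos hδ).ne'
  have hinvx : dx (fun w => (regGradNorm v δ w)⁻¹) z = _ := fderiv_inv_regGradNorm hδ hdx hdy 1
  have hinvy : dy (fun w => (regGradNorm v δ w)⁻¹) z = _ :=
    fderiv_inv_regGradNorm hδ hdx hdy Complex.I
  have hWsq : regGradNorm v δ z ^ 2 = dx v z ^ 2 + dy v z ^ 2 + δ ^ 2 := by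
    rw [regGradNorm_sq, gradNorm_sq]
  have hxy := dx_dy_eq_dy_dx hΩ hv hz
  rw [dx_mul hdx hinv, dy_mul hdy hinv, hinvx, hinvy, regCurvature]
  simp only [dx, dy] at hxy hWsq ⊢
  field_simp
  rw [hWsq, hxy]
  ring

end RegularizedCurvature

section FluxInequality

variable {v χ : ℂ → ℝ} {h : ℝ → ℝ} {Ω B : Set ℂ} {δ M : ℝ}

theorem integrable_gradNorm (hχ : ContDiff ℝ 1 χ) (hχc : HasCompactSupport χ) :
    Integrable (gradNorm χ) := by
  simpa only [funext (gradNorm_eq_norm_fderiv χ)] using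
    (hχ.continuous_fderiv one_ne_zero).norm.integrable_of_hasCompactSupport
      (hχc.fderiv ℝ).norm

theorem divergence_comp_mul_regularized_field {z : ℂ} (hΩ : IsOpen Ω) (hv : ContDiffOn ℝ 2 v Ω)
    (hh : ContDiff ℝ 1 h) (hδ : δ ≠ 0) (hz : z ∈ Ω) :
    dx (fun w => h (v w) * (dx v w * (regGradNorm v δ w)⁻¹)) z +
        dy (fun w => h (v w) * (dy v w * (regGradNorm v δ w)⁻¹)) z =
      deriv h (v z) * gradNorm v z * (gradNorm v z / regGradNorm v δ z)
        - h (v z) * regCurvature v δ z := by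
  have differentiableAt {f : ℂ → ℝ} (hf : ContDiffOn ℝ 1 f Ω) : DifferentiableAt ℝ f z :=
    (hf.differentiableOn one_ne_zero).differentiableAt (hΩ.mem_nhds hz)
  have hv1 := hv.of_le one_le_two
  have hinv := contDiffOn_inv_regGradNorm hΩ hv hδ
  have hcomp : DifferentiableAt ℝ (fun w => h (v w)) z :=
    differentiableAt (hh.comp_contDiffOn hv1)
  have chain_rule := fderiv_comp_apply (hh.differentiable one_ne_zero (v z)) (differentiableAt hv1)
  rw [dx_mul hcomp (differentiableAt ((contDiffOn_dx hΩ hv).mul hinv)),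
    dy_mul hcomp (differentiableAt ((contDiffOn_dy hΩ hv).mul hinv)),
    eq_sub_of_add_eq (dx_add_dy_regularized_field hΩ hv hδ hz), ← mul_div_assoc,
    mul_assoc (deriv h (v z)), ← sq, gradNorm_sq]
  simp only [dx, dy, chain_rule, div_eq_mul_inv]
  ring

theorem integral_regularized_flux_eq (hΩ : IsOpen Ω) (hv : ContDiffOn ℝ 2 v Ω)
    (hh : ContDiff ℝ 1 h) (hχ : ContDiff ℝ 1 χ) (hχc : HasCompactSupport χ)
    (hχΩ : tsupport χ ⊆ Ω) (hδ : δ ≠ 0) :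
    ∫ z, χ z * (deriv h (v z) * gradNorm v z * (gradNorm v z / regGradNorm v δ z)
        - h (v z) * regCurvature v δ z) =
      -∫ z, h (v z) * ((dx χ z * dx v z + dy χ z * dy v z) / regGradNorm v δ z) := by
  have hcomp := hh.comp_contDiffOn (hv.of_le one_le_two)
  have hinv := contDiffOn_inv_regGradNorm hΩ hv hδ
  have hdiv := integral_mul_divergence_eq_neg hΩ hχ hχc hχΩ
    (hcomp.mul ((contDiffOn_dx hΩ hv).mul hinv)) (hcomp.mul ((contDiffOn_dy hΩ hv).mul hinv))
  refine (integral_congr_ae (.of_forall fun z => ?_)).trans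
    (hdiv.trans (congrArg Neg.neg (integral_congr_ae (.of_forall fun z => ?_))))
  · by_cases hz : z ∈ tsupport χ
    · exact congrArg (χ z * ·)
        (divergence_comp_mul_regularized_field hΩ hv hh hδ (hχΩ hz)).symm
    · simp only [image_eq_zero_of_notMem_tsupport hz, zero_mul]
  · simp only [Function.comp_apply, div_eq_mul_inv]
    ring

theorem integrable_mul_deriv_comp_mul_gradNorm (hΩ : IsOpen Ω) (hv : ContDiffOn ℝ 1 v Ω)
    (hh : ContDiff ℝ 1 h) (hχ : Continuous χ) (hχc : HasCompactSupport χ)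
    (hχΩ : tsupport χ ⊆ Ω) :
    Integrable fun z => χ z * (deriv h (v z) * gradNorm v z) :=
  integrable_mul_of_tsupport_subset hχ hχc hχΩ
    (((hh.continuous_deriv le_rfl).comp_continuousOn hv.continuousOn).mul
      (continuousOn_gradNorm hΩ hv))

theorem norm_gradNorm_div_regGradNorm_le (v : ℂ → ℝ) (δ : ℝ) (z : ℂ) :
    ‖gradNorm v z / regGradNorm v δ z‖ ≤ 1 := by
  rw [Real.norm_of_nonneg (div_nonneg (gradNorm_nonneg v z) (regGradNorm_nonneg v δ z))]
  exact div_le_one_of_le₀ gradNorm_le_regGradNorm (regGradNorm_nonneg v δ z)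

theorem neg_integral_cutoff_flux_le (hhM : ∀ t, |h t| ≤ M) (hχ : ContDiff ℝ 1 χ)
    (hχc : HasCompactSupport χ) :
    -∫ z, h (v z) * ((dx χ z * dx v z + dy χ z * dy v z) / regGradNorm v δ z) ≤
      M * ∫ z, gradNorm χ z := by
  rw [← integral_const_mul]
  refine (neg_le_abs _).trans ((Real.norm_eq_abs _).symm.trans_le (norm_integral_le_of_norm_le
    ((integrable_gradNorm hχ hχc).const_mul M) (.of_forall fun z => ?_)))
  rw [norm_mul, norm_div, Real.norm_of_nonneg (regGradNorm_nonneg v δ z)]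
  refine mul_le_mul (hhM _) (div_le_of_le_mul₀ (regGradNorm_nonneg v δ z) (gradNorm_nonneg χ z) ?_)
    (div_nonneg (norm_nonneg _) (regGradNorm_nonneg v δ z)) ((abs_nonneg _).trans (hhM 0))
  exact (abs_dx_mul_dx_add_dy_mul_dy_le v χ z).trans
    (mul_le_mul_of_nonneg_left gradNorm_le_regGradNorm (gradNorm_nonneg χ z))

theorem integral_regularized_flux_le (hΩ : IsOpen Ω) (hv : ContDiffOn ℝ 2 v Ω)
    (hBΩ : B ⊆ Ω) (hBm : MeasurableSet B) (hh : ContDiff ℝ 1 h) (hhM : ∀ t, |h t| ≤ M)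
    (hχ : ContDiff ℝ 1 χ) (hχc : HasCompactSupport χ) (hχB : tsupport χ ⊆ B)
    (hχ01 : ∀ z, χ z ∈ Icc 0 1) (hδ : δ ≠ 0) (hint : IntegrableOn (regCurvature v δ) B) :
    ∫ z, χ z * (deriv h (v z) * gradNorm v z) * (gradNorm v z / regGradNorm v δ z) ≤
      M * ((∫ z in B, |regCurvature v δ z|) + ∫ z, gradNorm χ z) := by
  have hv1 := hv.of_le one_le_two
  have integrable_layer : Integrable fun z =>
      χ z * (deriv h (v z) * gradNorm v z) * (gradNorm v z / regGradNorm v δ z) := by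
    refine (integrable_mul_deriv_comp_mul_gradNorm hΩ hv1 hh hχ.continuous hχc
      (hχB.trans hBΩ)).mul_bdd ?_ (.of_forall (norm_gradNorm_div_regGradNorm_le v δ))
    exact ((measurable_gradNorm v).div (measurable_regGradNorm v δ)).aestronglyMeasurable
  have norm_weight_le (z : ℂ) : ‖χ z * h (v z)‖ ≤ M := by
    rw [norm_mul, Real.norm_of_nonneg (hχ01 z).1]
    exact (mul_le_of_le_one_left (norm_nonneg _) (hχ01 z).2).trans (hhM _)
  have eq_zero_off_B (z : ℂ) (hz : z ∉ B) : χ z * h (v z) * regCurvature v δ z = 0 := by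
    rw [image_eq_zero_of_notMem_tsupport fun hzχ => hz (hχB hzχ), zero_mul, zero_mul]
  have integrableOn_curvature :
      IntegrableOn (fun z => χ z * h (v z) * regCurvature v δ z) B :=
    hint.bdd_mul ((hχ.continuous.continuousOn.mul ((hh.continuous.comp_continuousOn
      hv.continuousOn).mono hBΩ)).aestronglyMeasurable hBm) (.of_forall norm_weight_le)
  have curvature_le : ∫ z, χ z * h (v z) * regCurvature v δ z ≤
      M * ∫ z in B, |regCurvature v δ z| := by
    rw [← setIntegral_eq_integral_of_forall_compl_eq_zero eq_zero_off_B, ← integral_const_mul]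
    refine integral_mono integrableOn_curvature (hint.abs.const_mul M) fun z => ?_
    exact (le_abs_self _).trans ((norm_mul_le _ _).trans
      (mul_le_mul_of_nonneg_right (norm_weight_le z) (abs_nonneg _)))
  have cutoff_le := neg_integral_cutoff_flux_le (v := v) (δ := δ) hhM hχ hχc
  have flux_eq := integral_regularized_flux_eq hΩ hv hh hχ hχc (hχB.trans hBΩ) hδ
  have split := integral_sub integrable_layer
    (integrableOn_curvature.integrable_of_forall_notMem_eq_zero eq_zero_off_B)
  simp only [mul_sub, ← mul_assoc] at flux_eq split ⊢
  linarith

theorem tendsto_integral_mul_gradNorm_div_regGradNorm {G : ℂ → ℝ} (hG : Integrable G)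
    (hG0 : ∀ z, gradNorm v z = 0 → G z = 0) :
    Tendsto (fun δ => ∫ z, G z * (gradNorm v z / regGradNorm v δ z)) (𝓝 0)
      (𝓝 (∫ z, G z)) := by
  refine tendsto_integral_filter_of_dominated_convergence (fun z => ‖G z‖)
    (.of_forall fun δ => ?_) (.of_forall fun δ => .of_forall fun z => ?_) hG.norm
    (.of_forall fun z => ?_)
  · exact hG.aestronglyMeasurable.mul
      ((measurable_gradNorm v).div (measurable_regGradNorm v δ)).aestronglyMeasurable
  · rw [norm_mul]
    exact mul_le_of_le_one_right (norm_nonneg _) (norm_gradNorm_div_regGradNorm_le v δ z)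
  · by_cases hz : gradNorm v z = 0
    · simp [hG0 z hz]
    · have hlim := (continuous_regGradNorm_param v z).tendsto 0
      rw [regGradNorm_zero] at hlim
      simpa [hz] using ((tendsto_const_nhds (x := gradNorm v z)).div hlim hz).const_mul (G z)

theorem integrableOn_regCurvature
    (hint : IntegrableOn (fun z => hessNorm v z / gradNorm v z) B)
    (hreg : ∀ᵐ z ∂volume.restrict B, gradNorm v z ≠ 0) (δ : ℝ) :
    IntegrableOn (regCurvature v δ) B :=
  (hint.const_mul 2).mono' (measurable_regCurvature v δ).aestronglyMeasurable
    (hreg.mono fun _ hz => abs_regCurvature_le δ hz)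

theorem tendsto_integral_abs_regCurvature
    (hint : IntegrableOn (fun z => hessNorm v z / gradNorm v z) B)
    (hreg : ∀ᵐ z ∂volume.restrict B, gradNorm v z ≠ 0) :
    Tendsto (fun δ => ∫ z in B, |regCurvature v δ z|) (𝓝 0)
      (𝓝 (∫ z in B, |levelCurvature v z|)) := by
  rw [← regCurvature_zero]
  refine tendsto_integral_filter_of_dominated_convergence _
    (.of_forall fun δ => (measurable_regCurvature v δ).norm.aestronglyMeasurable)
    (.of_forall fun δ => hreg.mono fun z hz => ?_) (hint.const_mul 2)
    (hreg.mono fun z hz => (continuousAt_regCurvature_zero hz).tendsto.abs)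
  rw [Real.norm_eq_abs, abs_abs]
  exact abs_regCurvature_le δ hz

theorem integral_flux_le (hΩ : IsOpen Ω) (hv : ContDiffOn ℝ 2 v Ω) (hBΩ : B ⊆ Ω)
    (hBm : MeasurableSet B) (hint : IntegrableOn (fun z => hessNorm v z / gradNorm v z) B)
    (hreg : ∀ᵐ z ∂volume.restrict B, gradNorm v z ≠ 0)
    (hh : ContDiff ℝ 1 h) (hhM : ∀ t, |h t| ≤ M) (hχ : ContDiff ℝ 1 χ)
    (hχc : HasCompactSupport χ) (hχB : tsupport χ ⊆ B) (hχ01 : ∀ z, χ z ∈ Icc 0 1) :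
    ∫ z, χ z * (deriv h (v z) * gradNorm v z) ≤
      M * ((∫ z in B, |levelCurvature v z|) + ∫ z, gradNorm χ z) := by
  have layer_limit := (tendsto_integral_mul_gradNorm_div_regGradNorm (v := v)
    (integrable_mul_deriv_comp_mul_gradNorm hΩ (hv.of_le one_le_two) hh hχ.continuous hχc
      (hχB.trans hBΩ)) fun z hz => by rw [hz, mul_zero, mul_zero]).mono_left
        (nhdsWithin_le_nhds (s := {0}ᶜ))
  have curvature_limit :=
    ((tendsto_integral_abs_regCurvature hint hreg).add_const (∫ z, gradNorm χ z)).const_mul M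
  refine le_of_tendsto_of_tendsto layer_limit (curvature_limit.mono_left nhdsWithin_le_nhds) ?_
  filter_upwards [self_mem_nhdsWithin] with δ hδ
  exact integral_regularized_flux_le hΩ hv hBΩ hBm hh hhM hχ hχc hχB hχ01 hδ
    (integrableOn_regCurvature hint hreg δ)

end FluxInequality

section RadialCutoff

open Metric

variable {a b t r R : ℝ} {q ρ : ℝ → ℝ} {z₀ : ℂ}

/-- A `C¹` monotone step from `0` on `(-∞, a]` to `1` on `[b, ∞)`, when `a < b`. It serves both for
radial cutoff functions and for concentrating a divergence identity on a level set. -/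
noncomputable def smoothStep (a b t : ℝ) : ℝ := Real.smoothTransition ((t - a) / (b - a))

theorem contDiff_smoothStep (a b : ℝ) : ContDiff ℝ 1 (smoothStep a b) :=
  Real.smoothTransition.contDiff.comp (by fun_prop)

theorem smoothStep_mem_Icc (a b t : ℝ) : smoothStep a b t ∈ Icc 0 1 :=
  ⟨Real.smoothTransition.nonneg _, Real.smoothTransition.le_one _⟩

theorem monotone_smoothStep (hab : a ≤ b) : Monotone (smoothStep a b) := fun _ _ hst =>
  Real.smoothTransition.monotone <|
    div_le_div_of_nonneg_right (sub_le_sub_right hst a) (sub_nonneg.2 hab)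

theorem smoothStep_of_le (hab : a ≤ b) (ht : t ≤ a) : smoothStep a b t = 0 :=
  Real.smoothTransition.zero_of_nonpos <|
    div_nonpos_of_nonpos_of_nonneg (sub_nonpos.2 ht) (sub_nonneg.2 hab)

theorem smoothStep_of_ge (hab : a < b) (ht : b ≤ t) : smoothStep a b t = 1 :=
  Real.smoothTransition.one_of_one_le <|
    (one_le_div (sub_pos.2 hab)).2 (sub_le_sub_right ht a)

theorem gradNorm_radial (hq : Differentiable ℝ q) (z₀ z : ℂ) :
    gradNorm (fun w => q (‖w - z₀‖ ^ 2)) z = |deriv (fun y => q (y ^ 2)) ‖z - z₀‖| := by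
  have hsq : HasFDerivAt (fun w : ℂ => ‖w - z₀‖ ^ 2) ((2 : ℝ) • innerSL ℝ (z - z₀)) z := by
    simpa [two_smul] using ((hasFDerivAt_id z).sub_const z₀).norm_sq
  have hpow : deriv (fun y => q (y ^ 2)) ‖z - z₀‖ =
      deriv q (‖z - z₀‖ ^ 2) * (2 * ‖z - z₀‖) := by
    simpa [Function.comp_def] using
      ((hq _).hasDerivAt.comp ‖z - z₀‖ (hasDerivAt_pow 2 _)).deriv
  have hfderiv : HasFDerivAt (fun w => q (‖w - z₀‖ ^ 2)) _ z :=
    (hq _).hasDerivAt.comp_hasFDerivAt z hsq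
  rw [gradNorm_eq_norm_fderiv, hfderiv.fderiv, hpow, norm_smul, norm_smul, innerSL_apply_norm,
    abs_mul, abs_mul, abs_norm]
  rfl

theorem integral_mul_abs_deriv_le (hρ : Differentiable ℝ ρ) (hρ' : ∀ y > 0, deriv ρ y ≤ 0)
    (hρR : ∀ y ≥ R, ρ y = 0) : ∫ y in Ioi 0, y * |deriv ρ y| ≤ R * ρ 0 := by
  have hderiv (y : ℝ) (hy : y ∈ Ioi 0) : HasDerivAt (-ρ) |deriv ρ y| y :=
    (hρ y).hasDerivAt.neg.congr_deriv (abs_of_nonpos (hρ' y hy)).symm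
  have hcont : ContinuousWithinAt (-ρ) (Ici 0) 0 :=
    hρ.continuous.neg.continuousWithinAt
  have hlim : Tendsto (-ρ) atTop (𝓝 0) := tendsto_const_nhds.congr' <| by
    filter_upwards [eventually_ge_atTop R] with y hy
    rw [Pi.neg_apply, hρR y hy, neg_zero]
  have hnonneg : ∀ y ∈ Ioi (0 : ℝ), 0 ≤ |deriv ρ y| := fun y _ => abs_nonneg _
  have hint : IntegrableOn (fun y => |deriv ρ y|) (Ioi 0) :=
    integrableOn_Ioi_deriv_of_nonneg hcont hderiv hnonneg hlim
  have hle (y : ℝ) : y * |deriv ρ y| ≤ R * |deriv ρ y| := by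
    rcases le_or_gt y R with hy | hy
    · exact mul_le_mul_of_nonneg_right hy (abs_nonneg _)
    · have hzero : ρ =ᶠ[𝓝 y] fun _ => 0 := by
        filter_upwards [lt_mem_nhds hy] with x hx using hρR x hx.le
      rw [hzero.deriv_eq, deriv_const, abs_zero, mul_zero, mul_zero]
  calc ∫ y in Ioi 0, y * |deriv ρ y|
      ≤ ∫ y in Ioi 0, R * |deriv ρ y| := by
        refine integral_mono_of_nonneg ?_ (hint.const_mul R) (ae_of_all _ hle)
        filter_upwards [ae_restrict_mem measurableSet_Ioi] with y hy
          using mul_nonneg (le_of_lt hy) (abs_nonneg _)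
    _ = R * ρ 0 := by
        rw [integral_const_mul, integral_Ioi_of_hasDerivAt_of_nonneg hcont hderiv hnonneg hlim,
          Pi.neg_apply, zero_sub, neg_neg]

theorem integral_gradNorm_radial_le (hq : Differentiable ℝ q) (hq' : Antitone q)
    (hqR : ∀ t ≥ R ^ 2, q t = 0) (hR : 0 ≤ R) (z₀ : ℂ) :
    ∫ z, gradNorm (fun w => q (‖w - z₀‖ ^ 2)) z ≤ 2 * Real.pi * R * q 0 := by
  set ρ : ℝ → ℝ := fun y => q (y ^ 2) with hρdef
  have hρ' (y : ℝ) (hy : y > 0) : deriv ρ y ≤ 0 := by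
    refine ((hq _).hasDerivAt.comp y (hasDerivAt_pow 2 y)).deriv.trans_le ?_
    exact mul_nonpos_of_nonpos_of_nonneg hq'.deriv_nonpos (by positivity)
  have hbound : ∫ y in Ioi 0, y * |deriv ρ y| ≤ R * ρ 0 :=
    integral_mul_abs_deriv_le (by fun_prop) hρ' fun y hy => hqR _ (by gcongr)
  calc ∫ z, gradNorm (fun w => q (‖w - z₀‖ ^ 2)) z
      = ∫ z : ℂ, |deriv ρ ‖z‖| := by
        simp only [gradNorm_radial hq]
        exact integral_sub_right_eq_self (fun z : ℂ => |deriv ρ ‖z‖|) z₀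
    _ = 2 * Real.pi * ∫ y in Ioi 0, y * |deriv ρ y| := by
        rw [integral_fun_norm_addHaar volume fun y => |deriv ρ y|]
        simp [Complex.finrank_real_complex, Measure.real, Complex.volume_ball]
        ring
    _ ≤ 2 * Real.pi * (R * ρ 0) := by gcongr
    _ = 2 * Real.pi * R * q 0 := by simp only [hρdef]; ring_nf

theorem exists_radial_cutoff (z₀ : ℂ) (hr : 0 ≤ r) (hrR : r < R) :
    ∃ χ : ℂ → ℝ, ContDiff ℝ 1 χ ∧ HasCompactSupport χ ∧ tsupport χ ⊆ ball z₀ R ∧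
      (∀ z, χ z ∈ Icc 0 1) ∧ (∀ z ∈ closedBall z₀ r, χ z = 1) ∧
      ∫ z, gradNorm χ z ≤ 2 * Real.pi * R := by
  obtain ⟨s, hrs, hsR⟩ := exists_between hrR
  have hs : 0 ≤ s := hr.trans hrs.le
  have hrs2 : r ^ 2 < s ^ 2 := by gcongr
  set q : ℝ → ℝ := fun t => 1 - smoothStep (r ^ 2) (s ^ 2) t with hqdef
  have hq : ContDiff ℝ 1 q := contDiff_const.sub (contDiff_smoothStep _ _)
  have hqs (t : ℝ) (ht : t ≥ s ^ 2) : q t = 0 := by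
    simp only [hqdef, smoothStep_of_ge hrs2 ht, sub_self]
  have hqr (t : ℝ) (ht : t ≤ r ^ 2) : q t = 1 := by
    simp only [hqdef, smoothStep_of_le hrs2.le ht, sub_zero]
  have hsupp : tsupport (fun z => q (‖z - z₀‖ ^ 2)) ⊆ closedBall z₀ s := by
    refine closure_minimal (fun z hz => ?_) isClosed_closedBall
    by_contra h
    rw [mem_closedBall_iff_norm, not_le] at h
    exact hz (hqs _ (by gcongr))
  refine ⟨fun z => q (‖z - z₀‖ ^ 2),
    hq.comp ((contDiff_norm_sq ℝ).comp (contDiff_id.sub contDiff_const)),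
    (isCompact_closedBall z₀ s).of_isClosed_subset (isClosed_tsupport _) hsupp,
    hsupp.trans (closedBall_subset_ball hsR),
    fun z => Icc.mem_iff_one_sub_mem.1 (smoothStep_mem_Icc _ _ _), fun z hz => hqr _ ?_, ?_⟩
  · rw [mem_closedBall_iff_norm] at hz
    gcongr
  calc ∫ z, gradNorm (fun w => q (‖w - z₀‖ ^ 2)) z
      ≤ 2 * Real.pi * s * q 0 :=
        integral_gradNorm_radial_le (hq.differentiable one_ne_zero)
          (fun _ _ h => sub_le_sub_left (monotone_smoothStep hrs2.le h) 1) hqs hs z₀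
    _ ≤ 2 * Real.pi * R := by
        rw [hqr 0 (sq_nonneg r), mul_one]
        gcongr

end RadialCutoff

section LocalLength

open Metric

variable {v : ℂ → ℝ} {Ω A V W s : Set ℂ} {ν : Circle} {p a z w : ℂ} {c ε η m : ℝ}

/-- The density of the area of the transition layer `{|v - c| < ε}`, weighted so that its integral
across the layer is `1`. As `ε → 0⁺` it tends to the length of the level set `{v = c}`. -/
noncomputable def layerDensity (v : ℂ → ℝ) (c ε : ℝ) (z : ℂ) : ENNReal :=
  ENNReal.ofReal (deriv (smoothStep (c - ε) (c + ε)) (v z) * gradNorm v z)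

/-- The second coordinate of `z` in the orthonormal frame `(ν, ν i)`. It parametrizes level curves
whose normal is close to `ν`. -/
noncomputable def tangentCoord (ν : Circle) (z : ℂ) : ℝ := ((rotation ν).symm z).im

theorem continuous_tangentCoord (ν : Circle) : Continuous (tangentCoord ν) :=
  Complex.continuous_im.comp (rotation ν).symm.continuous

theorem continuousOn_layerDensity (hΩ : IsOpen Ω) (hv : ContDiffOn ℝ 1 v Ω) (c ε : ℝ) :
    ContinuousOn (layerDensity v c ε) Ω :=
  ENNReal.continuous_ofReal.comp_continuousOn <|
    (((contDiff_smoothStep _ _).continuous_deriv le_rfl).comp_continuousOn hv.continuousOn).mul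
      (continuousOn_gradNorm hΩ hv)

theorem rotation_mk (ν : Circle) (x y : ℝ) :
    rotation ν ⟨x, y⟩ = x • (ν : ℂ) + y • (ν * Complex.I) := by
  rw [rotation_apply, Complex.mk_eq_add_mul_I, Complex.real_smul, Complex.real_smul]
  ring

theorem measurePreserving_rotation_mk (ν : Circle) :
    MeasurePreserving (fun q : ℝ × ℝ => rotation ν ⟨q.1, q.2⟩) :=
  (rotation ν).measurePreserving.comp Complex.volume_preserving_equiv_real_prod.symm

theorem exists_normal (hΩ : IsOpen Ω) (hv : ContDiffOn ℝ 1 v Ω) (hp : p ∈ Ω)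
    (hreg : gradNorm v p ≠ 0) :
    ∃ ν : Circle, ∃ ρ > 0, ∃ m > 0, ball p ρ ⊆ Ω ∧ ∀ z ∈ ball p ρ,
      m ≤ fderiv ℝ v z ν ∧ |fderiv ℝ v z (ν * Complex.I)| ≤ fderiv ℝ v z ν := by
  set G := gradNorm v p with hG
  have hG0 : 0 < G := (gradNorm_nonneg v p).lt_of_ne' hreg
  have hnorm : ‖gradVec v p / G‖ = 1 := by
    rw [norm_div, norm_gradVec, Complex.norm_of_nonneg hG0.le, div_self hreg]
  let ν : Circle := ⟨gradVec v p / G, mem_sphere_zero_iff_norm.2 hnorm⟩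
  have hνre : (ν : ℂ).re = dx v p / G := Complex.div_ofReal_re _ _
  have hνim : (ν : ℂ).im = dy v p / G := Complex.div_ofReal_im _ _
  have hnormal : fderiv ℝ v p ν = G := by
    rw [fderiv_apply_eq, hνre, hνim]
    field_simp
    rw [hG, gradNorm_sq]
  have htangent : fderiv ℝ v p (ν * Complex.I) = 0 := by
    rw [fderiv_apply_eq, Complex.mul_I_re, Complex.mul_I_im, hνre, hνim]
    ring
  have hcont (e : ℂ) : ContinuousAt (fun z => fderiv ℝ v z e) p :=
    (contDiffOn_fderiv_apply hΩ hv (zero_add 1).le e).continuousOn.continuousAt (hΩ.mem_nhds hp)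
  have hlower : ∀ᶠ z in 𝓝 p, G / 2 < fderiv ℝ v z ν :=
    (hcont _).eventually (lt_mem_nhds ((half_lt_self hG0).trans_eq hnormal.symm))
  have hupper : ∀ᶠ z in 𝓝 p, |fderiv ℝ v z (ν * Complex.I)| < G / 2 :=
    (hcont _).abs.eventually (gt_mem_nhds <|
      (congrArg abs htangent).trans_lt (abs_zero.trans_lt (half_pos hG0)))
  obtain ⟨ρ, hρ, hball⟩ :=
    eventually_nhds_iff_ball.1 (hlower.and (hupper.and (hΩ.mem_nhds hp)))
  exact ⟨ν, ρ, hρ, G / 2, half_pos hG0, fun z hz => (hball z hz).2.2,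
    fun z hz => ⟨(hball z hz).1.le, ((hball z hz).2.1.trans (hball z hz).1).le⟩⟩

theorem dist_le_two_mul_dist_tangentCoord (hs : Convex ℝ s)
    (hd : ∀ x ∈ s, DifferentiableAt ℝ v x)
    (hν : ∀ x ∈ s, 0 < fderiv ℝ v x ν ∧ |fderiv ℝ v x (ν * Complex.I)| ≤ fderiv ℝ v x ν)
    (hz : z ∈ s) (hw : w ∈ s) (hzw : v z = v w) :
    dist z w ≤ 2 * dist (tangentCoord ν z) (tangentCoord ν w) := by
  obtain ⟨ξ, hξ, hmvt⟩ := domain_mvt (f' := fderiv ℝ v)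
    (fun x hx => (hd x hx).hasFDerivAt.hasFDerivWithinAt) hs hw hz
  obtain ⟨hpos, hle⟩ := hν ξ (hs.segment_subset hw hz hξ)
  set d := (rotation ν).symm (z - w) with hdef
  have hdecomp : z - w = d.re • (ν : ℂ) + d.im • (ν * Complex.I) := by
    rw [← rotation_mk, Complex.eta, hdef, LinearIsometryEquiv.apply_symm_apply]
  have hzero : d.re * fderiv ℝ v ξ ν = -(d.im * fderiv ℝ v ξ (ν * Complex.I)) := by
    rw [hzw, sub_self, hdecomp, map_add, map_smul, map_smul] at hmvt
    exact eq_neg_of_add_eq_zero_left hmvt.symm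
  have hre : |d.re| ≤ |d.im| := by
    refine le_of_mul_le_mul_right ?_ hpos
    calc |d.re| * fderiv ℝ v ξ ν = |d.re * fderiv ℝ v ξ ν| := by rw [abs_mul, abs_of_pos hpos]
      _ = |d.im| * |fderiv ℝ v ξ (ν * Complex.I)| := by rw [hzero, abs_neg, abs_mul]
      _ ≤ |d.im| * fderiv ℝ v ξ ν := by gcongr
  calc dist z w = ‖d‖ := by rw [dist_eq_norm, hdef, LinearIsometryEquiv.norm_map]
    _ ≤ |d.re| + |d.im| := Complex.norm_le_abs_re_add_abs_im d
    _ ≤ 2 * |d.im| := by linarith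
    _ = 2 * dist (tangentCoord ν z) (tangentCoord ν w) := by
        rw [Real.dist_eq, tangentCoord, tangentCoord, ← Complex.sub_im, ← map_sub]

theorem hausdorffMeasure_one_le_mul_volume_image {X : Type*} [MetricSpace X] [MeasurableSpace X]
    [BorelSpace X] {A : Set X} {π : X → ℝ} {K : NNReal}
    (h : ∀ z ∈ A, ∀ w ∈ A, dist z w ≤ K * dist (π z) (π w)) : μH[1] A ≤ K * volume (π '' A) := by
  have hanti : AntilipschitzWith K (fun z : A => π z) :=
    AntilipschitzWith.of_le_mul_dist fun z w => h z z.2 w w.2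
  have himage : (fun z : A => π z) '' univ = π '' A := by
    rw [image_univ, ← image_eq_range]
  have hsubtype := (isometry_subtype_coe (s := A)).hausdorffMeasure_image (Or.inl zero_le_one) univ
  rw [image_univ, Subtype.range_coe] at hsubtype
  simpa [hsubtype, himage, hausdorffMeasure_real]
    using hanti.le_hausdorffMeasure_image zero_le_one univ

theorem measure_le_lintegral_prod {α β : Type*} [MeasurableSpace α] [MeasurableSpace β]
    {μ : Measure α} {κ : Measure β} [SFinite μ] [SFinite κ] {g : α × β → ENNReal}
    (hg : AEMeasurable g (μ.prod κ)) {S : Set β} (hS : ∀ y ∈ S, 1 ≤ ∫⁻ x, g (x, y) ∂μ) :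
    κ S ≤ ∫⁻ q, g q ∂μ.prod κ := by
  rw [lintegral_prod_symm _ hg]
  calc κ S ≤ κ {y | 1 ≤ ∫⁻ x, g (x, y) ∂μ} := measure_mono hS
    _ ≤ ∫⁻ y, ∫⁻ x, g (x, y) ∂μ ∂κ := by
        simpa using mul_meas_ge_le_lintegral₀ hg.lintegral_prod_left' 1

theorem lintegral_deriv_smoothStep_comp {a b x₁ x₂ : ℝ} {φ φ' : ℝ → ℝ} (hab : a < b)
    (hx : x₁ ≤ x₂) (hφ : ∀ x ∈ Icc x₁ x₂, HasDerivAt φ (φ' x) x)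
    (hφ' : ContinuousOn φ' (Icc x₁ x₂)) (hpos : ∀ x ∈ Icc x₁ x₂, 0 ≤ φ' x) (h₁ : φ x₁ ≤ a)
    (h₂ : b ≤ φ x₂) :
    ∫⁻ x in Icc x₁ x₂, ENNReal.ofReal (deriv (smoothStep a b) (φ x) * φ' x) = 1 := by
  have hcont : ContinuousOn (fun x => deriv (smoothStep a b) (φ x) * φ' x) (Icc x₁ x₂) :=
    (((contDiff_smoothStep a b).continuous_deriv le_rfl).comp_continuousOn
      (HasDerivAt.continuousOn hφ)).mul hφ'
  have hderiv (x : ℝ) (hx : x ∈ Icc x₁ x₂) : HasDerivAt (fun x => smoothStep a b (φ x))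
      (deriv (smoothStep a b) (φ x) * φ' x) x :=
    ((contDiff_smoothStep a b).differentiable one_ne_zero _).hasDerivAt.comp x (hφ x hx)
  have hftc : ∫ x in x₁..x₂, deriv (smoothStep a b) (φ x) * φ' x = 1 := by
    rw [intervalIntegral.integral_eq_sub_of_hasDerivAt
      (fun x hx' => hderiv x (by rwa [uIcc_of_le hx] at hx'))
      (hcont.intervalIntegrable_of_Icc hx), smoothStep_of_le hab.le h₁, smoothStep_of_ge hab h₂,
      sub_zero]
  rw [intervalIntegral.integral_of_le hx, ← integral_Icc_eq_integral_Ioc] at hftc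
  rw [← ofReal_integral_eq_lintegral_ofReal hcont.integrableOn_Icc, hftc, ENNReal.ofReal_one]
  filter_upwards [ae_restrict_mem measurableSet_Icc] with x hx
  exact mul_nonneg (monotone_smoothStep hab.le).deriv_nonneg (hpos x hx)

theorem lintegral_deriv_smoothStep_comp_of_le {x₀ : ℝ} {φ φ' : ℝ → ℝ}
    (hφ : ∀ x ∈ Icc (x₀ - η) (x₀ + η), HasDerivAt φ (φ' x) x)
    (hφ' : ContinuousOn φ' (Icc (x₀ - η) (x₀ + η))) (hm : ∀ x ∈ Icc (x₀ - η) (x₀ + η), m ≤ φ' x)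
    (hm₀ : 0 < m) (hη : 0 < η) (hε : 0 < ε) (hεη : ε ≤ m * η) (hx₀ : φ x₀ = c) :
    ∫⁻ x in Icc (x₀ - η) (x₀ + η),
      ENNReal.ofReal (deriv (smoothStep (c - ε) (c + ε)) (φ x) * φ' x) = 1 := by
  have hgrowth := (convex_Icc (x₀ - η) (x₀ + η)).mul_sub_le_image_sub_of_le_deriv
    (HasDerivAt.continuousOn hφ)
    (fun x hx => (hφ x (interior_subset hx)).differentiableAt.differentiableWithinAt)
    (C := m) fun x hx => (hm x (interior_subset hx)).trans_eq (hφ x (interior_subset hx)).deriv.symm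
  have hleft := hgrowth (x₀ - η) ⟨le_rfl, by linarith⟩ x₀ ⟨by linarith, by linarith⟩ (by linarith)
  have hright := hgrowth x₀ ⟨by linarith, by linarith⟩ (x₀ + η) ⟨by linarith, le_rfl⟩ (by linarith)
  rw [hx₀, sub_sub_cancel] at hleft
  rw [hx₀, add_sub_cancel_left] at hright
  exact lintegral_deriv_smoothStep_comp (by linarith) (by linarith) hφ hφ'
    (fun x hx => hm₀.le.trans (hm x hx)) (by linarith) (by linarith)

theorem one_le_lintegral_layerDensity_line (hW : IsOpen W) (hv : ContDiffOn ℝ 1 v W)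
    (hν : ∀ z ∈ W, m ≤ fderiv ℝ v z ν) (hm : 0 < m) (hη : 0 < η) (hε : 0 < ε) (hεη : ε ≤ m * η)
    (haW : closedBall a η ⊆ W) (ha : v a = c) :
    1 ≤ ∫⁻ x : ℝ, W.indicator (layerDensity v c ε) (rotation ν ⟨x, tangentCoord ν a⟩) := by
  set y := tangentCoord ν a
  set x₀ := ((rotation ν).symm a).re
  set ℓ : ℝ → ℂ := fun x => rotation ν ⟨x, y⟩
  have hℓ (x : ℝ) : ℓ x = x • (ν : ℂ) + y • (ν * Complex.I) := rotation_mk ν x y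
  have hℓ₀ : ℓ x₀ = a := (rotation ν).apply_symm_apply a
  have hℓ' (x : ℝ) : HasDerivAt ℓ ν x := by
    simpa only [funext hℓ, one_smul, id] using
      ((hasDerivAt_id x).smul_const (ν : ℂ)).add_const (y • (ν * Complex.I))
  have hmem : ∀ x ∈ Icc (x₀ - η) (x₀ + η), ℓ x ∈ W := fun x hx => haW <| by
    rwa [← hℓ₀, mem_closedBall, dist_eq_norm, hℓ, hℓ, add_sub_add_right_eq_sub, ← sub_smul,
      norm_smul, Circle.norm_coe, mul_one, ← dist_eq_norm, ← mem_closedBall, Real.closedBall_eq_Icc]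
  have hφ : ∀ x ∈ Icc (x₀ - η) (x₀ + η), HasDerivAt (fun x => v (ℓ x)) (fderiv ℝ v (ℓ x) ν) x :=
    fun x hx => (differentiableAt_of_mem hW hv (hmem x hx)).hasFDerivAt.comp_hasDerivAt x (hℓ' x)
  have hφ' : ContinuousOn (fun x => fderiv ℝ v (ℓ x) ν) (Icc (x₀ - η) (x₀ + η)) :=
    (contDiffOn_fderiv_apply hW hv (zero_add 1).le _).continuousOn.comp
      (HasDerivAt.continuousOn fun x _ => hℓ' x) hmem
  calc 1 = ∫⁻ x in Icc (x₀ - η) (x₀ + η), ENNReal.ofReal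
          (deriv (smoothStep (c - ε) (c + ε)) (v (ℓ x)) * fderiv ℝ v (ℓ x) ν) :=
        (lintegral_deriv_smoothStep_comp_of_le hφ hφ' (fun x hx => hν _ (hmem x hx)) hm hη hε hεη
          (hℓ₀ ▸ ha)).symm
    _ ≤ ∫⁻ x in Icc (x₀ - η) (x₀ + η), W.indicator (layerDensity v c ε) (ℓ x) := by
        refine setLIntegral_mono' measurableSet_Icc fun x hx => ?_
        rw [indicator_of_mem (hmem x hx), layerDensity, gradNorm_eq_norm_fderiv]
        exact ENNReal.ofReal_le_ofReal <| mul_le_mul_of_nonneg_left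
          ((le_abs_self _).trans ((fderiv ℝ v (ℓ x)).unit_le_opNorm _ (Circle.norm_coe ν).le))
          (monotone_smoothStep (by linarith)).deriv_nonneg
    _ ≤ ∫⁻ x, W.indicator (layerDensity v c ε) (ℓ x) := setLIntegral_le_lintegral _ _

theorem volume_tangentCoord_image_le (hs : IsOpen s) (hv : ContDiffOn ℝ 1 v s)
    (hν : ∀ z ∈ s, m ≤ fderiv ℝ v z ν) (hm : 0 < m) (hA : IsCompact A)
    (hAs : A ⊆ s ∩ v ⁻¹' {c}) (hV : IsOpen V) (hAV : A ⊆ V) :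
    ∀ᶠ ε in 𝓝[>] 0, volume (tangentCoord ν '' A) ≤ ∫⁻ z in V, layerDensity v c ε z := by
  have hW : IsOpen (V ∩ s) := hV.inter hs
  obtain ⟨η, hη, hηW⟩ := hA.exists_cthickening_subset_open hW
    (subset_inter hAV (hAs.trans inter_subset_left))
  filter_upwards [Ioo_mem_nhdsGT (show 0 < m * η by positivity)] with ε hε
  have hmeas : Measurable ((V ∩ s).indicator (layerDensity v c ε)) := by
    classical
    rw [← piecewise_eq_indicator]
    exact ((continuousOn_layerDensity hs hv c ε).mono inter_subset_right).measurable_piecewise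
      continuousOn_const hW.measurableSet
  have hframe := measurePreserving_rotation_mk ν
  calc volume (tangentCoord ν '' A)
      ≤ ∫⁻ q : ℝ × ℝ, (V ∩ s).indicator (layerDensity v c ε) (rotation ν ⟨q.1, q.2⟩) := by
        refine measure_le_lintegral_prod (hmeas.comp hframe.measurable).aemeasurable ?_
        rintro _ ⟨a, ha, rfl⟩
        exact one_le_lintegral_layerDensity_line hW (hv.mono inter_subset_right)
          (fun z hz => hν z hz.2) hm hη hε.1 hε.2.le
          ((closedBall_subset_cthickening ha η).trans hηW) (hAs ha).2
    _ = ∫⁻ z in V ∩ s, layerDensity v c ε z := by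
        rw [hframe.lintegral_comp hmeas, lintegral_indicator hW.measurableSet]
    _ ≤ ∫⁻ z in V, layerDensity v c ε z := lintegral_mono_set inter_subset_left

end LocalLength

section LevelSetLength

open Metric

variable {v : ℂ → ℝ} {Ω U₁ U₂ K V : Set ℂ} {z₀ p : ℂ} {c R : ℝ}

/-- The length of the level set `{v = c}` in `U` is finite, and up to any error it is bounded on
compact pieces by twice the weighted area of thin transition layers. The latter are confined to an
arbitrary open set `V` so that the bounds for two sets can be added without counting a layer
twice. -/
def HasLayerBound (v : ℂ → ℝ) (c : ℝ) (U : Set ℂ) : Prop :=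
  μH[1] (U ∩ v ⁻¹' {c}) < ⊤ ∧
  ∀ A V : Set ℂ, IsCompact A → A ⊆ U ∩ v ⁻¹' {c} → IsOpen V → A ⊆ V → ∀ θ : ENNReal, θ ≠ 0 →
    ∀ᶠ ε in 𝓝[>] 0, μH[1] A ≤ 2 * (∫⁻ z in V, layerDensity v c ε z) + θ

theorem hasLayerBound_empty (v : ℂ → ℝ) (c : ℝ) : HasLayerBound v c ∅ := by
  refine ⟨by simp, fun A V _ hA _ _ θ _ => ?_⟩
  rw [empty_inter, subset_empty_iff] at hA
  simp [hA]

theorem exists_isCompact_subset_measure_lt_add {X : Type*} [PseudoMetricSpace X] [CompleteSpace X]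
    [SecondCountableTopology X] [MeasurableSpace X] [BorelSpace X] {μ : Measure X} {E : Set X}
    (hE : MeasurableSet E) (hfin : μ E < ⊤) {θ : ENNReal} (hθ : θ ≠ 0) :
    ∃ A ⊆ E, IsCompact A ∧ μ E < μ A + θ := by
  have : IsFiniteMeasure (μ.restrict E) := ⟨by rwa [Measure.restrict_apply_univ]⟩
  obtain ⟨A, hAE, hA, hlt⟩ := hE.exists_isCompact_lt_add (μ := μ.restrict E) (measure_ne_top _ _) hθ
  rw [Measure.restrict_apply_self] at hlt
  exact ⟨A, hAE, hA, hlt.trans_le (by gcongr; exact Measure.restrict_le_self)⟩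

theorem HasLayerBound.union (h₁ : HasLayerBound v c U₁) (h₂ : HasLayerBound v c U₂)
    (hU₁ : IsOpen U₁) : HasLayerBound v c (U₁ ∪ U₂) := by
  refine ⟨?_, fun A V hA hAU hV hAV θ hθ => ?_⟩
  · rw [union_inter_distrib_right]
    exact (measure_union_le _ _).trans_lt (ENNReal.add_lt_top.2 ⟨h₁.1, h₂.1⟩)
  have hθ₃ : θ / 3 ≠ 0 := (ENNReal.div_pos hθ (by simp)).ne'
  have hsub : A ∩ U₁ ⊆ U₁ ∩ v ⁻¹' {c} := fun z hz => ⟨hz.2, (hAU hz.1).2⟩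
  obtain ⟨A₁, hA₁A, hA₁, hlt⟩ : ∃ A₁ ⊆ A ∩ U₁, IsCompact A₁ ∧ μH[1] (A ∩ U₁) < μH[1] A₁ + θ / 3 :=
    exists_isCompact_subset_measure_lt_add (hA.isClosed.measurableSet.inter hU₁.measurableSet)
      ((measure_mono hsub).trans_lt h₁.1) hθ₃
  have hA₂ : IsCompact (A \ U₁) := hA.diff hU₁
  have hA₂' : A \ U₁ ⊆ U₂ ∩ v ⁻¹' {c} :=
    fun z hz => ⟨(hAU hz.1).1.resolve_left hz.2, (hAU hz.1).2⟩
  obtain ⟨V₁, V₂, hV₁, hV₂, hAV₁, hAV₂, hdisj⟩ :=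
    SeparatedNhds.of_isCompact_isCompact hA₁ hA₂ <|
      disjoint_sdiff_right.mono_left (hA₁A.trans inter_subset_right)
  filter_upwards [
    h₁.2 A₁ (V ∩ V₁) hA₁ (hA₁A.trans hsub) (hV.inter hV₁)
      (subset_inter ((hA₁A.trans inter_subset_left).trans hAV) hAV₁) (θ / 3) hθ₃,
    h₂.2 (A \ U₁) (V ∩ V₂) hA₂ hA₂' (hV.inter hV₂)
      (subset_inter (sdiff_subset.trans hAV) hAV₂) (θ / 3) hθ₃] with ε hε₁ hε₂
  have hlayers : (∫⁻ z in V ∩ V₁, layerDensity v c ε z) + ∫⁻ z in V ∩ V₂, layerDensity v c ε z ≤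
      ∫⁻ z in V, layerDensity v c ε z := by
    rw [← lintegral_union (hV.inter hV₂).measurableSet
      (hdisj.mono inter_subset_right inter_subset_right)]
    exact lintegral_mono_set (union_subset inter_subset_left inter_subset_left)
  calc μH[1] A
      ≤ μH[1] (A ∩ U₁) + μH[1] (A \ U₁) := measure_le_inter_add_sdiff _ _ _
    _ ≤ (2 * (∫⁻ z in V ∩ V₁, layerDensity v c ε z) + θ / 3 + θ / 3) +
          (2 * (∫⁻ z in V ∩ V₂, layerDensity v c ε z) + θ / 3) := by
        gcongr
        exact hlt.le.trans (by gcongr)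
    _ = 2 * ((∫⁻ z in V ∩ V₁, layerDensity v c ε z) + ∫⁻ z in V ∩ V₂, layerDensity v c ε z) +
          (θ / 3 + θ / 3 + θ / 3) := by ring
    _ ≤ 2 * (∫⁻ z in V, layerDensity v c ε z) + θ := by rw [ENNReal.add_thirds]; gcongr

theorem exists_isOpen_hasLayerBound (hΩ : IsOpen Ω) (hv : ContDiffOn ℝ 1 v Ω) (hp : p ∈ Ω)
    (hreg : gradNorm v p ≠ 0) (c : ℝ) : ∃ U, IsOpen U ∧ p ∈ U ∧ HasLayerBound v c U := by
  obtain ⟨ν, ρ, hρ, m, hm, hρΩ, hν⟩ := exists_normal hΩ hv hp hreg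
  have hlength (A : Set ℂ) (hA : A ⊆ ball p ρ ∩ v ⁻¹' {c}) :
      μH[1] A ≤ 2 * volume (tangentCoord ν '' A) :=
    hausdorffMeasure_one_le_mul_volume_image (K := 2) fun z hz w hw =>
      dist_le_two_mul_dist_tangentCoord (convex_ball p ρ)
        (fun x hx => differentiableAt_of_mem hΩ hv (hρΩ hx))
        (fun x hx => ⟨hm.trans_le (hν x hx).1, (hν x hx).2⟩) (hA hz).1 (hA hw).1
        ((hA hz).2.trans (hA hw).2.symm)
  refine ⟨ball p ρ, isOpen_ball, mem_ball_self hρ, ?_, fun A V hA hAU hV hAV θ _ => ?_⟩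
  · have hcompact := (isCompact_closedBall p ρ).image (continuous_tangentCoord ν)
    refine (hlength _ subset_rfl).trans_lt (ENNReal.mul_lt_top ENNReal.ofNat_lt_top ?_)
    exact (measure_mono (image_mono (inter_subset_left.trans ball_subset_closedBall))).trans_lt
      hcompact.measure_lt_top
  · filter_upwards [volume_tangentCoord_image_le isOpen_ball (hv.mono hρΩ) (fun z hz => (hν z hz).1)
      hm hA hAU hV hAV] with ε hε
    exact (hlength A hAU).trans ((by gcongr : _ ≤ _).trans le_self_add)

theorem eventually_hausdorffMeasure_le (hΩ : IsOpen Ω) (hv : ContDiffOn ℝ 1 v Ω)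
    (hK : IsCompact K) (hKΩ : K ⊆ Ω ∩ v ⁻¹' {c}) (hreg : ∀ z ∈ K, gradNorm v z ≠ 0)
    (hV : IsOpen V) (hKV : K ⊆ V) {θ : ENNReal} (hθ : θ ≠ 0) :
    ∀ᶠ ε in 𝓝[>] 0, μH[1] K ≤ 2 * (∫⁻ z in V, layerDensity v c ε z) + θ := by
  obtain ⟨U, -, hKU, hU⟩ : ∃ U, IsOpen U ∧ K ⊆ U ∧ HasLayerBound v c U := by
    refine hK.induction_on (p := fun E => ∃ U, IsOpen U ∧ E ⊆ U ∧ HasLayerBound v c U)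
      ⟨∅, isOpen_empty, subset_rfl, hasLayerBound_empty v c⟩ ?_ ?_ fun p hp => ?_
    · rintro s t hst ⟨U, hU, htU, h⟩
      exact ⟨U, hU, hst.trans htU, h⟩
    · rintro s t ⟨U₁, hU₁, hsU, h₁⟩ ⟨U₂, hU₂, htU, h₂⟩
      exact ⟨U₁ ∪ U₂, hU₁.union hU₂, union_subset_union hsU htU, h₁.union h₂ hU₁⟩
    · obtain ⟨U, hU, hpU, h⟩ := exists_isOpen_hasLayerBound hΩ hv (hKΩ hp).1 (hreg p hp) c
      exact ⟨U, mem_nhdsWithin_of_mem_nhds (hU.mem_nhds hpU), U, hU, subset_rfl, h⟩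
  exact hU.2 K V hK (subset_inter hKU (hKΩ.trans inter_subset_right)) hV hKV θ hθ

theorem two_mul_lintegral_layerDensity_ball_le (hΩ : IsOpen Ω) (hv : ContDiffOn ℝ 2 v Ω)
    (hB : ball z₀ R ⊆ Ω)
    (hint : IntegrableOn (fun z => hessNorm v z / gradNorm v z) (ball z₀ R))
    (hreg : ∀ᵐ z ∂volume.restrict (ball z₀ R), gradNorm v z ≠ 0) {s ε : ℝ} (hs : 0 ≤ s)
    (hsR : s < R) (hε : 0 < ε) (c : ℝ) :
    2 * ∫⁻ z in ball z₀ s, layerDensity v c ε z ≤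
      ENNReal.ofReal ((∫ z in ball z₀ R, |levelCurvature v z|) + 2 * Real.pi * R) := by
  obtain ⟨χ, hχ, hχc, hχB, hχ01, hχs, hχR⟩ := exists_radial_cutoff z₀ hs hsR
  set h : ℝ → ℝ := smoothStep (c - ε) (c + ε)
  have hh : ContDiff ℝ 1 h := contDiff_smoothStep _ _
  have hh' (t : ℝ) : 0 ≤ deriv h t := (monotone_smoothStep (by linarith)).deriv_nonneg
  -- Subtracting `1 / 2` centres the step and halves its sup norm, which gives the sharp constant.
  have hflux : ∫ z, χ z * (deriv h (v z) * gradNorm v z) ≤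
      1 / 2 * ((∫ z in ball z₀ R, |levelCurvature v z|) + ∫ z, gradNorm χ z) := by
    have hcentred (t : ℝ) : |h t - 1 / 2| ≤ 1 / 2 := by
      obtain ⟨h0, h1⟩ := smoothStep_mem_Icc (c - ε) (c + ε) t
      exact abs_le.2 ⟨by linarith, by linarith⟩
    simpa only [deriv_sub_const] using integral_flux_le hΩ hv hB measurableSet_ball hint hreg
      (hh.sub contDiff_const) hcentred hχ hχc hχB hχ01
  have hnonneg (z : ℂ) : 0 ≤ χ z * (deriv h (v z) * gradNorm v z) :=
    mul_nonneg (hχ01 z).1 (mul_nonneg (hh' _) (gradNorm_nonneg v z))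
  have hintegrable : Integrable fun z => χ z * (deriv h (v z) * gradNorm v z) :=
    integrable_mul_deriv_comp_mul_gradNorm hΩ (hv.of_le one_le_two) hh hχ.continuous hχc
      (hχB.trans hB)
  have hlayer : ∫⁻ z in ball z₀ s, layerDensity v c ε z ≤
      ENNReal.ofReal (∫ z, χ z * (deriv h (v z) * gradNorm v z)) := by
    rw [ofReal_integral_eq_lintegral_ofReal hintegrable (ae_of_all _ hnonneg)]
    refine (setLIntegral_mono' measurableSet_ball fun z hz => ?_).trans
      (setLIntegral_le_lintegral (ball z₀ s) _)
    rw [hχs z (ball_subset_closedBall hz), one_mul, layerDensity]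
  calc 2 * ∫⁻ z in ball z₀ s, layerDensity v c ε z
      ≤ ENNReal.ofReal 2 * ENNReal.ofReal (∫ z, χ z * (deriv h (v z) * gradNorm v z)) := by
        rw [ENNReal.ofReal_ofNat]
        gcongr
    _ = ENNReal.ofReal (2 * ∫ z, χ z * (deriv h (v z) * gradNorm v z)) :=
        (ENNReal.ofReal_mul zero_le_two).symm
    _ ≤ _ := ENNReal.ofReal_le_ofReal (by linarith)

theorem measure_ball_inter_le {X : Type*} [PseudoMetricSpace X] [MeasurableSpace X]
    {μ : Measure X} {S : Set X} {M : ENNReal} (z₀ : X) {R : ℝ}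
    (h : ∀ r < R, μ (closedBall z₀ r ∩ S) ≤ M) : μ (ball z₀ R ∩ S) ≤ M := by
  obtain ⟨r, hr, hrR, hlim⟩ := exists_seq_strictMono_tendsto R
  have hunion : ball z₀ R ∩ S = ⋃ n, closedBall z₀ (r n) ∩ S := by
    rw [← iUnion_inter]
    refine congrArg (· ∩ S) (Subset.antisymm (fun z hz => ?_) (iUnion_subset fun n =>
      closedBall_subset_ball (hrR n)))
    obtain ⟨n, hn⟩ := (hlim.eventually (lt_mem_nhds (mem_ball.1 hz))).exists
    exact mem_iUnion.2 ⟨n, hn.le⟩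
  have hmono : Monotone fun n => closedBall z₀ (r n) ∩ S := fun _ _ hmn =>
    inter_subset_inter_left _ (closedBall_subset_closedBall (hr.monotone hmn))
  rw [hunion, hmono.measure_iUnion]
  exact iSup_le fun n => h _ (hrR n)

theorem hausdorffMeasure_levelSet_le (hΩ : IsOpen Ω) (hv : ContDiffOn ℝ 2 v Ω)
    (hB : ball z₀ R ⊆ Ω)
    (hint : IntegrableOn (fun z => hessNorm v z / gradNorm v z) (ball z₀ R))
    (hreg : ∀ᵐ z ∂volume.restrict (ball z₀ R), gradNorm v z ≠ 0)
    (hc : ∀ z ∈ ball z₀ R, v z = c → gradNorm v z ≠ 0) :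
    μH[1] (ball z₀ R ∩ v ⁻¹' {c}) ≤
      ENNReal.ofReal ((∫ z in ball z₀ R, |levelCurvature v z|) + 2 * Real.pi * R) := by
  refine measure_ball_inter_le z₀ fun r hrR => ?_
  rcases lt_or_ge r 0 with hr | hr
  · simp [closedBall_eq_empty.2 hr]
  obtain ⟨s, hrs, hsR⟩ := exists_between hrR
  have hv1 : ContDiffOn ℝ 1 v Ω := hv.of_le one_le_two
  have hsub : closedBall z₀ r ⊆ ball z₀ R := closedBall_subset_ball hrR
  have hK : IsCompact (closedBall z₀ r ∩ v ⁻¹' {c}) :=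
    (isCompact_closedBall z₀ r).of_isClosed_subset
      ((hv.continuousOn.mono (hsub.trans hB)).preimage_isClosed_of_isClosed isClosed_closedBall
        isClosed_singleton) inter_subset_left
  refine ENNReal.le_of_forall_pos_le_add fun θ hθ _ => ?_
  have hlayers := eventually_hausdorffMeasure_le hΩ hv1 hK
    (inter_subset_inter_left _ (hsub.trans hB)) (fun z hz => hc z (hsub hz.1) hz.2) isOpen_ball
    (inter_subset_left.trans (closedBall_subset_ball hrs)) (ENNReal.coe_ne_zero.2 hθ.ne')
  obtain ⟨ε, hlayer, hε⟩ := (hlayers.and self_mem_nhdsWithin).exists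
  exact hlayer.trans (add_le_add_left
    (two_mul_lintegral_layerDensity_ball_le hΩ hv hB hint hreg (hr.trans hrs.le) hsR hε c) _)

end LevelSetLength

section Divergence

variable {v S : ℂ → ℝ} {U : Set ℂ}

theorem fderiv_rpow_mul {E : Type*} [NormedAddCommGroup E] [NormedSpace ℝ E] {S A : E → ℝ} {x : E}
    (hS : DifferentiableAt ℝ S x) (hpos : 0 < S x) (hA : DifferentiableAt ℝ A x) (s : ℝ) (e : E) :
    fderiv ℝ (fun y => S y ^ s * A y) x e =
      S x ^ (s - 1) * (S x * fderiv ℝ A x e + s * (fderiv ℝ S x e * A x)) := by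
  have hpow : S x ^ s = S x ^ (s - 1) * S x := by
    rw [← Real.rpow_add_one hpos.ne', sub_add_cancel]
  have hderiv : HasFDerivAt (fun y => S y ^ s * A y) _ x :=
    (hS.hasFDerivAt.rpow_const (Or.inl hpos.ne')).mul hA.hasFDerivAt
  rw [hderiv.fderiv, hpow]
  simp only [add_apply, smul_apply, smul_eq_mul]
  ring

theorem nondivergence_of_integral_rpow_mul_eq_zero (hU : IsOpen U) (hS : ContDiffOn ℝ 1 S U)
    (hpos : ∀ z ∈ U, 0 < S z) (hv : ContDiffOn ℝ 2 v U) {s : ℝ}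
    (h : ∀ φ, IsTest U φ → ∫ z, S z ^ s * (dx v z * dx φ z + dy v z * dy φ z) = 0) :
    ∀ z ∈ U, S z * (dx (dx v) z + dy (dy v) z) + s * (dx S z * dx v z + dy S z * dy v z) = 0 := by
  have hpow : ContDiffOn ℝ 1 (fun z => S z ^ s) U :=
    hS.rpow_const_of_ne fun z hz => (hpos z hz).ne'
  set P : ℂ → ℝ := fun z => S z ^ s * dx v z with hP
  set Q : ℂ → ℝ := fun z => S z ^ s * dy v z with hQ
  have hPc : ContDiffOn ℝ 1 P U := hpow.mul (contDiffOn_dx hU hv)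
  have hQc : ContDiffOn ℝ 1 Q U := hpow.mul (contDiffOn_dy hU hv)
  have hcont : ContinuousOn (fun z => dx P z + dy Q z) U :=
    (continuousOn_dx hU hPc).add (continuousOn_dy hU hQc)
  have hae : ∀ᵐ z, z ∈ U → dx P z + dy Q z = 0 := by
    refine hU.ae_eq_zero_of_integral_contDiff_smul_eq_zero
      (hcont.locallyIntegrableOn hU.measurableSet) fun φ hφ hφc hφU => ?_
    simp only [smul_eq_mul]
    rw [integral_mul_divergence_eq_neg hU (hφ.of_le (by simp)) hφc hφU hPc hQc, neg_eq_zero,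
      ← h φ ⟨hφ, hφc, hφU⟩]
    exact integral_congr_ae (ae_of_all _ fun z => by simp only [hP, hQ]; ring)
  intro z hz
  have hdiv : dx P z + dy Q z = 0 := Measure.eqOn_open_of_ae_eq
    ((ae_restrict_iff' hU.measurableSet).2 hae) hU hcont continuousOn_const hz
  have hSz := differentiableAt_of_mem hU hS hz
  rw [dx, dy, fderiv_rpow_mul hSz (hpos z hz)
    (differentiableAt_of_mem hU (contDiffOn_dx hU hv) hz), fderiv_rpow_mul hSz (hpos z hz)
    (differentiableAt_of_mem hU (contDiffOn_dy hU hv) hz), ← mul_add] at hdiv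
  have := (mul_eq_zero.1 hdiv).resolve_left (Real.rpow_pos_of_pos (hpos z hz) _).ne'
  simp only [dx, dy] at this ⊢
  linarith

end Divergence

section Ellipticity

open scoped RealInnerProductSpace

variable {V ι : Type*} [Fintype ι]

theorem norm_sum_sq_le [SeminormedAddCommGroup V] {τ : ι → ℝ} {w ξ : ι → V}
    (h : ∀ j, ‖ξ j‖ ≤ τ j * ‖w j‖) :
    ‖∑ j, ξ j‖ ^ 2 ≤ (∑ j, τ j ^ 2) * ∑ j, ‖w j‖ ^ 2 :=
  calc ‖∑ j, ξ j‖ ^ 2 ≤ (∑ j, τ j * ‖w j‖) ^ 2 := by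
        gcongr
        exact norm_sum_le_of_le _ fun j _ => h j
    _ ≤ _ := Finset.sum_mul_sq_le_sq_mul_sq _ _ _

theorem sum_sq_le_of_nondivergence [SeminormedAddCommGroup V] [InnerProductSpace ℝ V] {p : ℝ}
    (hp : 1 < p) {w ξ : ι → V} {D τ : ι → ℝ} (hξ : ∀ j, ‖ξ j‖ ≤ τ j * ‖w j‖)
    (hw : 0 < ∑ j, ‖w j‖ ^ 2)
    (h : ∀ i, (∑ j, ‖w j‖ ^ 2) * D i + (p - 2) * ⟪∑ j, ((D j / 2) • w j + ξ j), w i⟫ = 0) :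
    ∑ j, D j ^ 2 ≤ (2 * (p - 2)) ^ 2 * ∑ j, τ j ^ 2 := by
  set S := ∑ j, ‖w j‖ ^ 2
  set X := ∑ j, D j • w j with hX
  set Ξ := ∑ j, ξ j
  have hXle : ‖X‖ ^ 2 ≤ (∑ j, D j ^ 2) * S := by
    simpa only [sq_abs] using norm_sum_sq_le (τ := fun j => |D j|) (w := w)
      fun j => (norm_smul (D j) (w j)).le
  have hΞle : ‖Ξ‖ ^ 2 ≤ (∑ j, τ j ^ 2) * S := norm_sum_sq_le hξ
  have hhalf : ∑ j, ((D j / 2) • w j + ξ j) = (1 / 2 : ℝ) • X + Ξ := by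
    simp only [Finset.sum_add_distrib, hX, Finset.smul_sum, smul_smul, one_div_mul_eq_div, Ξ]
  have htested : S * ∑ j, D j ^ 2 + (p - 2) * (‖X‖ ^ 2 / 2 + ⟪Ξ, X⟫) = 0 := by
    have hsum : ∑ i, D i * (S * D i + (p - 2) * ⟪(1 / 2 : ℝ) • X + Ξ, w i⟫) = 0 :=
      Finset.sum_eq_zero fun i _ => by rw [← hhalf, h i, mul_zero]
    have hinner : ⟪(1 / 2 : ℝ) • X + Ξ, X⟫ = ‖X‖ ^ 2 / 2 + ⟪Ξ, X⟫ := by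
      rw [inner_add_left, real_inner_smul_left, real_inner_self_eq_norm_sq, one_div_mul_eq_div]
    rw [← hsum, ← hinner]
    nth_rewrite 2 [hX]
    simp only [inner_sum, real_inner_smul_right, Finset.mul_sum, ← Finset.sum_add_distrib]
    exact Finset.sum_congr rfl fun i _ => by ring
  rcases (Finset.sum_nonneg fun j _ => sq_nonneg (D j)).eq_or_lt with hD | hD
  · rw [← hD]; positivity
  have habsorb : S * (∑ j, D j ^ 2) / 2 ≤ -((p - 2) * ⟪Ξ, X⟫) := by
    nlinarith [mul_nonneg (sub_pos.2 hp).le (sq_nonneg ‖X‖)]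
  have hsq : (S * (∑ j, D j ^ 2) / 2) ^ 2 ≤
      (p - 2) ^ 2 * (((∑ j, τ j ^ 2) * S) * ((∑ j, D j ^ 2) * S)) :=
    calc (S * (∑ j, D j ^ 2) / 2) ^ 2 ≤ (-((p - 2) * ⟪Ξ, X⟫)) ^ 2 := by gcongr
      _ = (p - 2) ^ 2 * ⟪Ξ, X⟫ ^ 2 := by ring
      _ ≤ (p - 2) ^ 2 * (‖Ξ‖ ^ 2 * ‖X‖ ^ 2) := by
        rw [← mul_pow ‖Ξ‖]
        gcongr _ * ?_
        exact sq_le_sq.2 ((abs_real_inner_le_norm _ _).trans (le_abs_self _))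
      _ ≤ _ := by gcongr
  refine le_of_mul_le_mul_left ?_ (show 0 < S ^ 2 * ∑ j, D j ^ 2 by positivity)
  linarith

end Ellipticity

section ComplexGradient

variable {v : ℂ → ℝ} {Ω : Set ℂ} {z : ℂ}

/-- The Laplacian of a real function on the plane. -/
noncomputable def lapl (v : ℂ → ℝ) (z : ℂ) : ℝ := dx (dx v) z + dy (dy v) z

theorem complexGrad_eq (v : ℂ → ℝ) (z : ℂ) :
    complexGrad v z = (1 / 2 : ℂ) * starRingEnd ℂ (gradVec v z) := by
  simp [complexGrad, gradVec, Complex.ext_iff]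

theorem norm_complexGrad (v : ℂ → ℝ) (z : ℂ) : ‖complexGrad v z‖ = gradNorm v z / 2 := by
  rw [complexGrad_eq, norm_mul, Complex.norm_conj, norm_gradVec]
  norm_num [div_eq_inv_mul]

theorem norm_complexGrad_le_gradNorm (v : ℂ → ℝ) (z : ℂ) : ‖complexGrad v z‖ ≤ gradNorm v z :=
  (norm_complexGrad v z).trans_le (half_le_self (gradNorm_nonneg v z))

theorem fderiv_complexGrad (hx : DifferentiableAt ℝ (dx v) z) (hy : DifferentiableAt ℝ (dy v) z)
    (e : ℂ) : fderiv ℝ (complexGrad v) z e =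
      (1 / 2 : ℂ) * ((fderiv ℝ (dx v) z e : ℂ) - Complex.I * (fderiv ℝ (dy v) z e : ℂ)) := by
  have hcast {F : ℂ → ℝ} (hF : DifferentiableAt ℝ F z) :
      HasFDerivAt (fun w => (F w : ℂ)) (Complex.ofRealCLM.comp (fderiv ℝ F z)) z :=
    Complex.ofRealCLM.hasFDerivAt.comp z hF.hasFDerivAt
  have hgrad : HasFDerivAt (complexGrad v) _ z :=
    ((hcast hx).sub ((hcast hy).const_mul Complex.I)).const_mul (1 / 2 : ℂ)
  simp [hgrad.fderiv]

theorem wirtingerZ_complexGrad (hΩ : IsOpen Ω) (hv : ContDiffOn ℝ 2 v Ω) (hz : z ∈ Ω) :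
    wirtingerZ (complexGrad v) z =
      (1 / 2 : ℂ) * ⟨(dx (dx v) z - dy (dy v) z) / 2, -dy (dx v) z⟩ := by
  have hx := differentiableAt_of_mem hΩ (contDiffOn_dx hΩ hv) hz
  have hy := differentiableAt_of_mem hΩ (contDiffOn_dy hΩ hv) hz
  have hsymm := dx_dy_eq_dy_dx hΩ hv hz
  rw [wirtingerZ, fderiv_complexGrad hx hy, fderiv_complexGrad hx hy]
  simp only [dx, dy] at hsymm ⊢
  rw [hsymm]
  apply Complex.ext <;> simp <;> ring

theorem hessNorm_sq_eq (hΩ : IsOpen Ω) (hv : ContDiffOn ℝ 2 v Ω) (hz : z ∈ Ω) :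
    hessNorm v z ^ 2 = 8 * ‖wirtingerZ (complexGrad v) z‖ ^ 2 + lapl v z ^ 2 / 2 := by
  have hW : ‖wirtingerZ (complexGrad v) z‖ ^ 2 =
      (((dx (dx v) z - dy (dy v) z) / 2) ^ 2 + dy (dx v) z ^ 2) / 4 := by
    rw [wirtingerZ_complexGrad hΩ hv hz, ← Complex.normSq_eq_norm_sq, map_mul, Complex.normSq_mk]
    norm_num
    ring
  rw [hessNorm, Real.sq_sqrt (by positivity), dx_dy_eq_dy_dx hΩ hv hz, lapl, hW]
  ring

theorem gradVec_gradNorm_sq (hΩ : IsOpen Ω) (hv : ContDiffOn ℝ 2 v Ω) (hz : z ∈ Ω) :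
    gradVec (fun w => gradNorm v w ^ 2) z =
      lapl v z • gradVec v z +
        4 * starRingEnd ℂ (wirtingerZ (complexGrad v) z * gradVec v z) := by
  have hx := differentiableAt_of_mem hΩ (contDiffOn_dx hΩ hv) hz
  have hy := differentiableAt_of_mem hΩ (contDiffOn_dy hΩ hv) hz
  have hsymm := dx_dy_eq_dy_dx hΩ hv hz
  have hsq (e : ℂ) : fderiv ℝ (fun w => gradNorm v w ^ 2) z e =
      2 * (dx v z * fderiv ℝ (dx v) z e + dy v z * fderiv ℝ (dy v) z e) := by
    simp only [gradNorm_sq]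
    rw [fderiv_fun_add (hx.fun_pow 2) (hy.fun_pow 2), fderiv_fun_pow 2 hx, fderiv_fun_pow 2 hy]
    simp only [add_apply, smul_apply, smul_eq_mul]
    push_cast
    ring
  have hgrad : gradVec (fun w => gradNorm v w ^ 2) z =
      ⟨2 * (dx v z * dx (dx v) z + dy v z * dy (dx v) z),
        2 * (dx v z * dy (dx v) z + dy v z * dy (dy v) z)⟩ := by
    rw [← hsymm]
    nth_rewrite 2 [hsymm]
    exact congrArg₂ Complex.mk (hsq 1) (hsq Complex.I)
  rw [hgrad, wirtingerZ_complexGrad hΩ hv hz, lapl]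
  apply Complex.ext <;> simp [gradVec] <;> ring

end ComplexGradient

section PHarmonic

variable {p : ℝ} {Ω U : Set ℂ} {u : ℂ → Fin 2 → ℝ} {z : ℂ}

theorem jacNorm_sq (u : ℂ → Fin 2 → ℝ) (z : ℂ) :
    jacNorm u z ^ 2 = ∑ j, gradNorm (coord u j) z ^ 2 := by
  rw [jacNorm, Real.sq_sqrt (by positivity), Fin.sum_univ_two]

theorem contDiffOn_coord {n : WithTop ℕ∞} (hu : ContDiffOn ℝ n u Ω) (i : Fin 2) :
    ContDiffOn ℝ n (coord u i) Ω := contDiffOn_pi.1 hu i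

theorem contDiffOn_gradNorm_sq {v : ℂ → ℝ} (hΩ : IsOpen Ω) (hv : ContDiffOn ℝ 2 v Ω) :
    ContDiffOn ℝ 1 (fun z => gradNorm v z ^ 2) Ω := by
  simp only [gradNorm_sq]
  exact ((contDiffOn_dx hΩ hv).pow 2).add ((contDiffOn_dy hΩ hv).pow 2)

theorem contDiffOn_jacNorm_sq (hΩ : IsOpen Ω) (hu : ContDiffOn ℝ 2 u Ω) :
    ContDiffOn ℝ 1 (fun z => jacNorm u z ^ 2) Ω := by
  simp only [jacNorm_sq]
  exact ContDiffOn.sum fun j _ => contDiffOn_gradNorm_sq hΩ (contDiffOn_coord hu j)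

theorem gradVec_jacNorm_sq (hΩ : IsOpen Ω) (hu : ContDiffOn ℝ 2 u Ω) (hz : z ∈ Ω) :
    gradVec (fun w => jacNorm u w ^ 2) z =
      ∑ j, gradVec (fun w => gradNorm (coord u j) w ^ 2) z := by
  have hd (j : Fin 2) : DifferentiableAt ℝ (fun w => gradNorm (coord u j) w ^ 2) z :=
    differentiableAt_of_mem hΩ (contDiffOn_gradNorm_sq hΩ (contDiffOn_coord hu j)) hz
  simp only [jacNorm_sq, Fin.sum_univ_two, gradVec, dx, dy, fderiv_fun_add (hd 0) (hd 1)]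
  rfl

theorem IsPHarmonicMap.integral_eq_zero (hpu : IsPHarmonicMap p Ω u) (i : Fin 2) {φ : ℂ → ℝ}
    (hφ : IsTest Ω φ) : ∫ z, (jacNorm u z ^ 2) ^ ((p - 2) / 2) *
      (dx (coord u i) z * dx φ z + dy (coord u i) z * dy φ z) = 0 := by
  rw [← hpu i φ hφ, setIntegral_eq_integral_of_forall_compl_eq_zero fun z hz => by
    simp [dx, dy, fderiv_of_notMem_tsupport ℝ fun h => hz (hφ.2.2 h)]]
  refine integral_congr_ae (ae_of_all _ fun z => ?_)
  have hpow : (jacNorm u z ^ 2) ^ ((p - 2) / 2) = jacNorm u z ^ (p - 2) := by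
    have hJ : 0 ≤ jacNorm u z := Real.sqrt_nonneg _
    rw [← Real.rpow_natCast_mul hJ, Nat.cast_ofNat,
      mul_div_cancel₀ (p - 2) (two_ne_zero' ℝ)]
  simp only [hpow]

theorem IsPHarmonicMap.nondivergence (hpu : IsPHarmonicMap p Ω u) (hU : IsOpen U) (hUΩ : U ⊆ Ω)
    (hu : ContDiffOn ℝ 2 u U) (hJ : ∀ z ∈ U, jacNorm u z ≠ 0) (i : Fin 2) (hz : z ∈ U) :
    jacNorm u z ^ 2 * lapl (coord u i) z + (p - 2) / 2 *
      inner ℝ (gradVec (fun w => jacNorm u w ^ 2) z) (gradVec (coord u i) z) = 0 := by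
  have h := nondivergence_of_integral_rpow_mul_eq_zero hU (contDiffOn_jacNorm_sq hU hu)
    (fun z hz => by have := hJ z hz; positivity) (contDiffOn_coord hu i)
    (fun φ hφ => hpu.integral_eq_zero i ⟨hφ.1, hφ.2.1, hφ.2.2.trans hUΩ⟩) z hz
  rw [← h, Complex.inner, lapl]
  simp only [gradVec, Complex.mul_re, Complex.conj_re, Complex.conj_im]
  ring

theorem IsPHarmonicMap.sum_lapl_sq_le (hp : 1 < p) (hpu : IsPHarmonicMap p Ω u) (hU : IsOpen U)
    (hUΩ : U ⊆ Ω) (hu : ContDiffOn ℝ 2 u U) (hJ : ∀ z ∈ U, jacNorm u z ≠ 0) (hz : z ∈ U) :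
    ∑ j, lapl (coord u j) z ^ 2 ≤
      (2 * (p - 2)) ^ 2 * ∑ j, (2 * ‖wirtingerZ (complexGrad (coord u j)) z‖) ^ 2 := by
  have hS : jacNorm u z ^ 2 = ∑ j, ‖gradVec (coord u j) z‖ ^ 2 := by
    simp only [jacNorm_sq, norm_gradVec]
  refine sum_sq_le_of_nondivergence hp (w := fun j => gradVec (coord u j) z)
    (ξ := fun j => 2 * starRingEnd ℂ (wirtingerZ (complexGrad (coord u j)) z *
      gradVec (coord u j) z)) (fun j => ?_) ?_ fun i => ?_
  · rw [norm_mul, Complex.norm_conj, norm_mul, Complex.norm_ofNat, mul_assoc]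
  · have := hJ z hz
    rw [← hS]
    positivity
  · have hhalf : ∑ j, ((lapl (coord u j) z / 2) • gradVec (coord u j) z +
        2 * starRingEnd ℂ (wirtingerZ (complexGrad (coord u j)) z * gradVec (coord u j) z)) =
        (1 / 2 : ℝ) • gradVec (fun w => jacNorm u w ^ 2) z := by
      rw [gradVec_jacNorm_sq hU hu hz, Finset.smul_sum]
      refine Finset.sum_congr rfl fun j _ => ?_
      rw [gradVec_gradNorm_sq hU (contDiffOn_coord hu j) hz]
      simp only [Complex.real_smul]
      push_cast
      ring
    rw [← hpu.nondivergence hU hUΩ hu hJ i hz, hhalf, real_inner_smul_left, hS]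
    ring

theorem IsPHarmonicMap.hessNorm_le (hp : 1 < p) (hpu : IsPHarmonicMap p Ω u) (hU : IsOpen U)
    (hUΩ : U ⊆ Ω) (hu : ContDiffOn ℝ 2 u U) (hJ : ∀ z ∈ U, jacNorm u z ≠ 0) (i : Fin 2)
    (hz : z ∈ U) : hessNorm (coord u i) z ≤ Real.sqrt (8 + 8 * (p - 2) ^ 2) *
      ∑ j, ‖wirtingerZ (complexGrad (coord u j)) z‖ := by
  have hlapl := hpu.sum_lapl_sq_le hp hU hUΩ hu hJ hz
  have hsingle (a : Fin 2 → ℝ) : a i ^ 2 ≤ ∑ j, a j ^ 2 :=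
    Finset.single_le_sum (fun j _ => sq_nonneg (a j)) (Finset.mem_univ i)
  have hsum : ∑ j, ‖wirtingerZ (complexGrad (coord u j)) z‖ ^ 2 ≤
      (∑ j, ‖wirtingerZ (complexGrad (coord u j)) z‖) ^ 2 :=
    Finset.sum_sq_le_sq_sum_of_nonneg fun j _ => norm_nonneg _
  simp only [mul_pow, ← Finset.mul_sum] at hlapl
  refine le_of_sq_le_sq ?_ (by positivity)
  rw [hessNorm_sq_eq hU (contDiffOn_coord hu i) hz, mul_pow, Real.sq_sqrt (by positivity)]
  calc 8 * ‖wirtingerZ (complexGrad (coord u i)) z‖ ^ 2 + lapl (coord u i) z ^ 2 / 2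
      ≤ 8 * (∑ j, ‖wirtingerZ (complexGrad (coord u j)) z‖ ^ 2) +
          (∑ j, lapl (coord u j) z ^ 2) / 2 := by
        gcongr
        · exact hsingle fun j => ‖wirtingerZ (complexGrad (coord u j)) z‖
        · exact hsingle fun j => lapl (coord u j) z
    _ ≤ (8 + 8 * (p - 2) ^ 2) * ∑ j, ‖wirtingerZ (complexGrad (coord u j)) z‖ ^ 2 := by linarith
    _ ≤ _ := by gcongr

end PHarmonic

section Integrability

open Metric

variable {v : ℂ → ℝ} {Ω B : Set ℂ} {z₀ : ℂ} {R : ℝ}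

theorem integrableOn_hessNorm_div_gradNorm {b : ℂ → ℝ}
    (hb : ∀ᵐ z ∂volume.restrict B, 0 < b z ∧ b z ≤ gradNorm v z)
    (hint : IntegrableOn (fun z => hessNorm v z / b z) B) :
    IntegrableOn (fun z => hessNorm v z / gradNorm v z) B := by
  refine Integrable.mono' hint ?_ ?_
  · exact ((measurable_hessNorm v).div (measurable_gradNorm v)).aestronglyMeasurable
  · filter_upwards [hb] with z ⟨hbz, hle⟩
    have hnonneg := hessNorm_nonneg v z
    rw [Real.norm_of_nonneg (div_nonneg hnonneg (gradNorm_nonneg v z))]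
    gcongr

theorem integrableOn_norm_sub_rpow_neg_ball {E : Type*} [NormedAddCommGroup E] [NormedSpace ℝ E]
    [FiniteDimensional ℝ E] [Nontrivial E] [MeasurableSpace E] [BorelSpace E] (μ : Measure E)
    [μ.IsAddHaarMeasure] {α : ℝ} (hα : α < Module.finrank ℝ E) (x₀ : E) (R : ℝ) :
    IntegrableOn (fun x => ‖x - x₀‖ ^ (-α)) (ball x₀ R) μ := by
  have hlocal : LocallyIntegrable (fun x : E => ‖x‖ ^ (-α)) μ :=
    locallyIntegrable_of_norm_le_rpow Module.finrank_pos hα (C := 1)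
      (ae_of_all _ fun x => by rw [one_mul, Real.norm_of_nonneg (by positivity)])
      (measurable_norm.pow_const _).aestronglyMeasurable
  have hcentred : IntegrableOn (fun x : E => ‖x‖ ^ (-α)) (ball 0 R) μ :=
    (hlocal.integrableOn_isCompact (isCompact_closedBall 0 R)).mono_set ball_subset_closedBall
  have hpre : (fun x => x - x₀) ⁻¹' ball 0 R = ball x₀ R := by
    ext x
    simp [dist_eq_norm]
  rw [← hpre]
  exact ((measurePreserving_sub_right μ x₀).integrableOn_comp_preimage
    (MeasurableEquiv.subRight x₀).measurableEmbedding).2 hcentred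

theorem integrableOn_div_norm_sub_rpow {F : ℂ → ℝ}
    (hF : ContinuousOn F (closedBall z₀ R)) {α : ℝ} (hα : α < 2) :
    IntegrableOn (fun z => F z / ‖z - z₀‖ ^ α) (ball z₀ R) := by
  have hsing : IntegrableOn (fun z : ℂ => ‖z - z₀‖ ^ (-α)) (ball z₀ R) :=
    integrableOn_norm_sub_rpow_neg_ball volume (by simpa using hα) z₀ R
  refine (hsing.continuousOn_mul_of_subset hF (isCompact_closedBall z₀ R) measurableSet_ball
    ball_subset_closedBall).congr_fun (fun z _ => ?_) measurableSet_ball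
  simp only [Real.rpow_neg (norm_nonneg _), div_eq_mul_inv]

theorem IsPHarmonicMap.integrableOn_hessNorm {p : ℝ} {U : Set ℂ} {u : ℂ → Fin 2 → ℝ} (hp : 1 < p)
    (hpu : IsPHarmonicMap p Ω u) (hU : IsOpen U) (hUΩ : U ⊆ Ω) (hu : ContDiffOn ℝ 2 u U)
    (hJ : ∀ z ∈ U, jacNorm u z ≠ 0)
    (hW : ∀ j, IntegrableOn (wirtingerZ (complexGrad (coord u j))) U) (i : Fin 2) :
    IntegrableOn (hessNorm (coord u i)) U := by
  have hsum : IntegrableOn (fun z => ∑ j, ‖wirtingerZ (complexGrad (coord u j)) z‖) U :=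
    integrable_finsetSum _ fun j _ => (hW j).norm
  refine Integrable.mono' (hsum.const_mul (Real.sqrt (8 + 8 * (p - 2) ^ 2)))
    (measurable_hessNorm (coord u i)).aestronglyMeasurable ?_
  filter_upwards [ae_restrict_mem hU.measurableSet] with z hz
  rw [Real.norm_of_nonneg (hessNorm_nonneg (coord u i) z)]
  exact hpu.hessNorm_le hp hU hUΩ hu hJ i hz

theorem gradNorm_coord_le_jacNorm (u : ℂ → Fin 2 → ℝ) (i : Fin 2) (z : ℂ) :
    gradNorm (coord u i) z ≤ jacNorm u z :=
  Real.le_sqrt_of_sq_le <| by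
    rw [← Fin.sum_univ_two fun j => gradNorm (coord u j) z ^ 2]
    exact Finset.single_le_sum (fun j _ => sq_nonneg (gradNorm (coord u j) z)) (Finset.mem_univ i)

theorem ae_pos_and_le_gradNorm (hB : MeasurableSet B) {b : ℂ → ℝ} (hb : ∀ z ≠ z₀, 0 < b z)
    (hg : ∀ z ∈ B, z ≠ z₀ → b z < ‖complexGrad v z‖) :
    ∀ᵐ z ∂volume.restrict B, 0 < b z ∧ b z ≤ gradNorm v z := by
  filter_upwards [ae_restrict_mem hB, ae_restrict_of_ae (Measure.ae_ne volume z₀)] with z hz hne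
  exact ⟨hb z hne, (hg z hz hne).le.trans (norm_complexGrad_le_gradNorm v z)⟩

theorem mem_criticalSet_iff {z : ℂ} : z ∈ criticalSet v Ω ↔ z ∈ Ω ∧ gradNorm v z = 0 := by
  rw [← sq_eq_zero_iff, gradNorm_sq, add_eq_zero_iff_of_nonneg (sq_nonneg _) (sq_nonneg _),
    sq_eq_zero_iff, sq_eq_zero_iff]
  rfl

end Integrability

theorem theorem3_general {Ω : Set ℂ} (hΩ : IsOpen Ω) {u : ℂ → Fin 2 → ℝ}
    (hu : ContDiffOn ℝ 2 u Ω) {C : ℝ} (hC : 0 < C) {z₀ : ℂ} {R : ℝ}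
    (hB : Metric.ball z₀ R ⊆ Ω) (i : Fin 2)
    (h :
      (IntegrableOn (hessNorm (coord u i)) (Metric.ball z₀ R) ∧
        ∀ z ∈ Metric.ball z₀ R, C < ‖complexGrad (coord u i) z‖) ∨
      ((∃ p : ℝ, 1 < p ∧ IsPHarmonicMap p Ω u) ∧
        (∀ j : Fin 2, IntegrableOn (wirtingerZ (complexGrad (coord u j))) (Metric.ball z₀ R)) ∧
        ∀ z ∈ Metric.ball z₀ R, C < ‖complexGrad (coord u i) z‖) ∨
      (Metric.closedBall z₀ R ⊆ Ω ∧
        ∃ α : ℝ, α < 2 ∧ ∀ z ∈ Metric.ball z₀ R, z ≠ z₀ →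
          C * ‖z - z₀‖ ^ α < ‖complexGrad (coord u i) z‖)) :
    IntegrableOn (levelCurvature (coord u i)) (Metric.ball z₀ R) ∧
    ∀ c : ℝ, Disjoint (criticalSet (coord u i) Ω) ({z ∈ Ω | coord u i z = c} ∩ Metric.ball z₀ R) →
      Measure.hausdorffMeasure 1 ({z ∈ Ω | coord u i z = c} ∩ Metric.ball z₀ R) ≤
        ENNReal.ofReal ((∫ z in Ω ∩ Metric.ball z₀ R, |levelCurvature (coord u i) z|)
          + 2 * Real.pi * R) := by
  have hv : ContDiffOn ℝ 2 (coord u i) Ω := contDiffOn_coord hu i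
  obtain ⟨b, hb, hint⟩ : ∃ b : ℂ → ℝ,
      (∀ᵐ z ∂volume.restrict (Metric.ball z₀ R), 0 < b z ∧ b z ≤ gradNorm (coord u i) z) ∧
        IntegrableOn (fun z => hessNorm (coord u i) z / b z) (Metric.ball z₀ R) := by
    rcases h with ⟨hH, hg⟩ | ⟨⟨p, hp, hpu⟩, hW, hg⟩ | ⟨hcl, α, hα, hg⟩
    · exact ⟨fun _ => C, ae_pos_and_le_gradNorm measurableSet_ball (fun _ _ => hC)
        fun z hz (_ : z ≠ z₀) => hg z hz, hH.div_const C⟩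
    · have hJ (z : ℂ) (hz : z ∈ Metric.ball z₀ R) : jacNorm u z ≠ 0 := (hC.trans (hg z hz)
        |>.trans_le (norm_complexGrad_le_gradNorm _ z)
        |>.trans_le (gradNorm_coord_le_jacNorm u i z)).ne'
      have hH := hpu.integrableOn_hessNorm hp Metric.isOpen_ball hB (hu.mono hB) hJ hW i
      exact ⟨fun _ => C, ae_pos_and_le_gradNorm measurableSet_ball (fun _ _ => hC)
        fun z hz (_ : z ≠ z₀) => hg z hz, hH.div_const C⟩
    · have hH := integrableOn_div_norm_sub_rpow ((continuousOn_hessNorm hΩ hv).mono hcl) hα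
      refine ⟨fun z => C * ‖z - z₀‖ ^ α, ae_pos_and_le_gradNorm measurableSet_ball
        (fun z hz => mul_pos hC (Real.rpow_pos_of_pos (norm_sub_pos_iff.2 hz) α)) hg, ?_⟩
      simpa only [IntegrableOn, div_div, mul_comm] using hH.div_const C
  have hint' := integrableOn_hessNorm_div_gradNorm hb hint
  have hreg : ∀ᵐ z ∂volume.restrict (Metric.ball z₀ R), gradNorm (coord u i) z ≠ 0 :=
    hb.mono fun z hz => (hz.1.trans_le hz.2).ne'
  refine ⟨regCurvature_zero (coord u i) ▸ integrableOn_regCurvature hint' hreg 0, fun c hc => ?_⟩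
  have hset : {z ∈ Ω | coord u i z = c} ∩ Metric.ball z₀ R =
      Metric.ball z₀ R ∩ coord u i ⁻¹' {c} :=
    (inter_right_comm _ _ _).trans (by rw [inter_eq_self_of_subset_right hB]; rfl)
  rw [hset] at hc ⊢
  rw [inter_eq_self_of_subset_right hB]
  exact hausdorffMeasure_levelSet_le hΩ hv hB hint' hreg fun z hz hzc h0 =>
    disjoint_left.1 hc (mem_criticalSet_iff.2 ⟨hB hz, h0⟩) ⟨hz, hzc⟩

theorem theorem3 (p : ℝ) (hp : 1 < p) (hp2 : p ≠ 2)
    (Ω : Set ℂ) (hΩ : IsOpen Ω) (hΩc : IsConnected Ω)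
    (u : ℂ → Fin 2 → ℝ) (hu : ContDiffOn ℝ 2 u Ω) (hpu : IsPHarmonicMap p Ω u)
    (C : ℝ) (hC : 0 < C) (z₀ : ℂ) (R : ℝ) (hR : 0 < R) (hB : Metric.ball z₀ R ⊆ Ω)
    (i : Fin 2)
    (h :
      -- (1)
      ((∀ j : Fin 2, MemLp (hessNorm (coord u j)) 2 (volume.restrict (Metric.ball z₀ R))) ∧
        ∀ z ∈ Metric.ball z₀ R, C < ‖complexGrad (coord u i) z‖) ∨
      -- (2)
      ((∀ j : Fin 2, MemLp (wirtingerZ (complexGrad (coord u j))) 2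
          (volume.restrict (Metric.ball z₀ R))) ∧
        ∀ z ∈ Metric.ball z₀ R, C < ‖complexGrad (coord u i) z‖) ∨
      -- (3)
      (Metric.closedBall z₀ R ⊆ Ω ∧
        (∀ j : Fin 2, QuasiregularOn (complexGrad (coord u j)) (Metric.ball z₀ R)) ∧
        ∀ z ∈ Metric.ball z₀ R, C < ‖complexGrad (coord u i) z‖) ∨
      -- (4)
      (Metric.closedBall z₀ R ⊆ Ω ∧
        (∀ j : Fin 2, QuasiregularOn (complexGrad (coord u j)) (Metric.ball z₀ R)) ∧
        ∃ α : ℝ, α < 1 ∧ ∀ z ∈ Metric.ball z₀ R, z ≠ z₀ →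
          C * ‖z - z₀‖ ^ α < ‖complexGrad (coord u i) z‖)) :
    IntegrableOn (levelCurvature (coord u i)) (Metric.ball z₀ R) ∧
    ((∀ z ∈ criticalSet (coord u i) Ω, ∀ᶠ w in 𝓝[≠] z, w ∉ criticalSet (coord u i) Ω) →
      ∀ c : ℝ, ({z ∈ Ω | coord u i z = c} ∩ Metric.ball z₀ R).Nonempty →
        Disjoint (criticalSet (coord u i) Ω)
          ({z ∈ Ω | coord u i z = c} ∩ Metric.ball z₀ R) →
        Measure.hausdorffMeasure 1 ({z ∈ Ω | coord u i z = c} ∩ Metric.ball z₀ R) ≤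
          ENNReal.ofReal ((∫ z in Ω ∩ Metric.ball z₀ R, |levelCurvature (coord u i) z|)
            + 2 * Real.pi * R)) := by
  have hfin : IsFiniteMeasure (volume.restrict (Metric.ball z₀ R)) :=
    isFiniteMeasure_restrict.2 measure_ball_lt_top.ne
  obtain ⟨hint, hlen⟩ := theorem3_general hΩ hu hC hB i <| by
    rcases h with ⟨hH, hg⟩ | ⟨hW, hg⟩ | ⟨hcl, -, hg⟩ | ⟨hcl, -, α, hα, hg⟩
    · exact .inl ⟨(hH i).integrable one_le_two, hg⟩
    · exact .inr <| .inl ⟨⟨p, hp, hpu⟩, fun j => (hW j).integrable one_le_two, hg⟩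
    · exact .inr <| .inr ⟨hcl, 0, two_pos, fun z hz _ => by simpa using hg z hz⟩
    · exact .inr <| .inr ⟨hcl, α, hα.trans one_lt_two, hg⟩
  exact ⟨hint, fun _ c _ hc => hlen c hc⟩
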